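/- Let $R$ be a commutative domain of finite character, i.e. every non-zero element of $R$ is contained in only finitely many maximal ideals, and let $Q$ be its field of fractions. Let $\Lambda$ be an associative unital $R$-algebra, not necessarily commutative, that is finitely generated as an $R$-module, and assume that $\Lambda\otimes_R Q$ is a simple artinian ring. Let $M=\bigoplus_{i\in\mathbb N_0}A_i$ and $N=\bigoplus_{i\in\mathbb N_0}B_i$, where all $A_i$ and $B_i$ are non-zero finitely generated right $\Lambda$-modules that are torsion-free as $R$-modules. Suppose that $M$ and $N$ are in the same genus, i.e. for every maximal ideal $\mathfrak m$ of $R$ the localizations $M_{\mathfrak m}$ and $N_{\mathfrak m}$ are isomorphic as right $\Lambda_{\mathfrak m}$-modules. Then there are $\Lambda$-submodules $M_i\subseteq M$ and $N_i\subseteq N$ $(i\in\mathbb N_0)$ such that $$M=\bigoplus_{i\in\mathbb N_0}M_i\qquad\text{and}\qquad N=\bigoplus_{i\in\mathbb N_0}N_i,$$ and, for every $i\in\mathbb N_0$, $M_i$ and $N_i$ are finitely generated and $M_i\cong N_i$ as right $\Lambda$-modules. In particular, $M\cong N$ as right $\Lambda$-modules. -/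

import Mathlib

open scoped DirectSum MulOpposite TensorProduct

/-- A commutative ring `R` (a domain, in the applications) has *finite character* if every non-zero
element of `R` lies in only finitely many maximal ideals. -/
def HasFiniteCharacter (R : Type*) [CommRing R] : Prop :=
  ∀ r : R, r ≠ 0 → {m : MaximalSpectrum R | r ∈ m.asIdeal}.Finite

/-! Right `Λ`-modules are modules over `Λᵐᵒᵖ`. For an `R`-algebra `Λ`, a right `Λ`-module `M` and a
multiplicative set `S ⊆ R`, the localization `S⁻¹M` is a right module over the ring `S⁻¹Λ` through
`(x / s) · (a / t) = (x · a) / (s t)`. -/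

namespace LocalizedModule

variable {R : Type*} [CommRing R] (S : Submonoid R)
  {Λ : Type*} [Ring Λ] [Algebra R Λ]
  {M : Type*} [AddCommGroup M] [Module R M] [Module Λᵐᵒᵖ M] [IsScalarTower R Λᵐᵒᵖ M]

theorem op_smul_smul_smul (r r' : R) (a : Λ) (x : M) :
    MulOpposite.op (r • a) • (r' • x) = (r' * r) • (MulOpposite.op a • x) := by
  rw [MulOpposite.op_smul, smul_assoc, smul_comm (MulOpposite.op a) r' x, smul_smul, mul_comm]

/-- The right action of `S⁻¹Λ` on `S⁻¹M`: `(x / s) · (a / t) = (x · a) / (s t)`. -/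
def rightSMul (b : LocalizedModule S Λ) (y : LocalizedModule S M) : LocalizedModule S M :=
  liftOn y (fun q => liftOn b (fun p => mk (MulOpposite.op p.1 • q.1) (q.2 * p.2)) (by
      rintro ⟨a, s⟩ ⟨a', s'⟩ ⟨u, hu⟩
      refine mk_eq.mpr ⟨u, ?_⟩
      obtain ⟨x, t⟩ := q
      simp only [Submonoid.smul_def, Submonoid.coe_mul] at hu ⊢
      have h := congrArg (fun c : Λ => MulOpposite.op c • ((t : R) • x)) hu
      simp only [smul_smul, op_smul_smul_smul] at h ⊢
      convert h using 2 <;> ring)) (by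
    rintro ⟨x, t⟩ ⟨x', t'⟩ ⟨u, hu⟩
    induction b with | _ a s
    simp only [liftOn_mk]
    refine mk_eq.mpr ⟨u, ?_⟩
    simp only [Submonoid.smul_def, Submonoid.coe_mul] at hu ⊢
    have h := congrArg (fun z : M => MulOpposite.op ((s : R) • a) • z) hu
    simp only [smul_smul, op_smul_smul_smul] at h ⊢
    convert h using 2 <;> ring)

instance rightModuleSMul : SMul (LocalizedModule S Λ)ᵐᵒᵖ (LocalizedModule S M) where
  smul b y := rightSMul S b.unop y

theorem op_mk_smul_mk (a : Λ) (t : S) (x : M) (s : S) :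
    MulOpposite.op (mk a t : LocalizedModule S Λ) • (mk x s : LocalizedModule S M) =
      mk (MulOpposite.op a • x) (s * t) := by
  change rightSMul S (mk a t) (mk x s) = _
  simp only [rightSMul, liftOn_mk]

/-- `S⁻¹M` as a right module over the localized ring `S⁻¹Λ`. -/
instance rightModule : Module (LocalizedModule S Λ)ᵐᵒᵖ (LocalizedModule S M) where
  one_smul y := by
    induction y with | _ x s
    rw [← MulOpposite.op_one, OreLocalization.one_def]
    exact (op_mk_smul_mk S (1 : Λ) 1 x s).trans (by simp)
  mul_smul b c y := by
    induction b using MulOpposite.rec' with | _ b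
    induction c using MulOpposite.rec' with | _ c
    induction b with | _ b t
    induction c with | _ c u
    induction y with | _ x s
    rw [← MulOpposite.op_mul, mk_mul_mk, op_mk_smul_mk, op_mk_smul_mk, op_mk_smul_mk,
      MulOpposite.op_mul, mul_smul, mul_assoc]
  smul_zero b := by
    induction b using MulOpposite.rec' with | _ b
    induction b with | _ b t
    rw [← zero_mk (1 : S), op_mk_smul_mk, smul_zero, zero_mk, zero_mk]
  smul_add b y z := by
    induction b using MulOpposite.rec' with | _ b
    induction b with | _ b t
    induction y with | _ x s
    induction z with | _ x' s'
    rw [mk_add_mk, op_mk_smul_mk, op_mk_smul_mk, op_mk_smul_mk, mk_add_mk]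
    refine mk_eq.mpr ⟨1, ?_⟩
    simp only [Submonoid.smul_def, Submonoid.coe_mul, one_smul, smul_add, smul_smul,
      smul_comm (MulOpposite.op b)]
    congr 2 <;> ring
  add_smul b c y := by
    induction b using MulOpposite.rec' with | _ b
    induction c using MulOpposite.rec' with | _ c
    induction b with | _ b t
    induction c with | _ c u
    induction y with | _ x s
    rw [← MulOpposite.op_add, mk_add_mk, op_mk_smul_mk, op_mk_smul_mk, op_mk_smul_mk, mk_add_mk]
    refine mk_eq.mpr ⟨1, ?_⟩
    simp only [Submonoid.smul_def, Submonoid.coe_mul, one_smul, smul_add, smul_smul,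
      MulOpposite.op_add, MulOpposite.op_smul, add_smul, smul_assoc]
    congr 2 <;> ring
  zero_smul y := by
    induction y with | _ x s
    rw [← MulOpposite.op_zero, ← zero_mk (1 : S), op_mk_smul_mk, MulOpposite.op_zero, zero_smul,
      zero_mk]

end LocalizedModule

/-- Two right `Λ`-modules `M` and `N` over an `R`-algebra `Λ` are *in the same genus* if, for every
maximal ideal `m` of `R`, the localizations `M_m` and `N_m` are isomorphic as right modules over
the localized algebra `Λ_m`. -/
def InSameGenus (R : Type*) [CommRing R] (Λ : Type*) [Ring Λ] [Algebra R Λ]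
    (M : Type*) [AddCommGroup M] [Module R M] [Module Λᵐᵒᵖ M] [IsScalarTower R Λᵐᵒᵖ M]
    (N : Type*) [AddCommGroup N] [Module R N] [Module Λᵐᵒᵖ N] [IsScalarTower R Λᵐᵒᵖ N] : Prop :=
  ∀ m : MaximalSpectrum R,
    Nonempty (LocalizedModule m.asIdeal.primeCompl M
      ≃ₗ[(LocalizedModule m.asIdeal.primeCompl Λ)ᵐᵒᵖ] LocalizedModule m.asIdeal.primeCompl N)

/-!
The theorem is proved by a back-and-forth argument. Write `T = Λᵐᵒᵖ`, so that right `Λ`-modules are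
left `T`-modules. At each step `M = P ⊕ D` and `N = P' ⊕ D'` with `P ≅ P'` finitely generated and
`D`, `D'` in the same genus; initially `P = P' = 0`. Given a finitely generated submodule of `M`, a
finitely generated direct summand `X` of `D` is chosen such that `P ⊕ X` contains it, and `X` is
matched with an isomorphic direct summand of `D'`, such that the complements of `X` in `D` and in
`D'` are again in the same genus. Alternating between `M` and `N` exhausts both modules. Two facts
make the step possible.

*`X` is a direct summand of `D'`* (`HasLargeComplements.exists_comp_eq_id`). It suffices to find
`f : X → D'` and `g : D' → X` with `g ∘ f = 1`. As `Λ ⊗ Q` is simple artinian, every module over it is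
a sum of copies of one simple module, so that `X` embeds rationally into any tail of the direct sum
(`exists_sum_comp_eq_smul`): there are `f`, `g` with `g ∘ f = r ≠ 0`, and this is a local splitting
away from the finitely many maximal ideals containing `r`. At these the local isomorphism of the
genus gives pairs `f`, `g` with composite a scalar outside the maximal ideal, and finitely many
such pairs can be patched by the Chinese remainder theorem and Nakayama's lemma
(`LinearMap.exists_comp_eq_smul_of_finset`). Hence two pairs suffice to split `X` off locally at
every maximal ideal. A rational embedding into a tail disjoint from both has composite some `r₂ ≠ 0`,
and patching the two pairs at the maximal ideals containing `r₂` gives a composite `s` coprime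
to `r₂`. A combination of these last two pairs has composite `1`.

*The complements are in the same genus* (`InSameGenus.ker`). This is cancellation of the localization
of `X` at a maximal ideal. By Evans' theorem (`HasStableRangeOne.nonempty_linearEquiv`) it holds
because the endomorphism ring of that localization has stable range one
(`Module.End.hasStableRangeOne`): reduction modulo the maximal ideal reflects units by Nakayama's
lemma, its image is a finite-dimensional algebra, and artinian rings have stable range one.
-/

/-! ### Stable range one and cancellation -/

/-- A ring has *stable range one* if `d * a + b = 1` implies that some `a + t * b` is a unit. -/
def HasStableRangeOne (E : Type*) [Ring E] : Prop :=
  ∀ d a b : E, d * a + b = 1 → ∃ t, IsUnit (a + t * b)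

/-- The element `t` is chosen such that the left ideal generated by `a + t * b` is maximal. -/
theorem IsSemisimpleRing.hasStableRangeOne (F : Type*) [Ring F] [IsSemisimpleRing F] :
    HasStableRangeOne F := by
  intro d a b hab
  obtain ⟨I, ⟨t, rfl⟩, hI⟩ := WellFounded.has_min (wellFounded_gt (α := Submodule F F))
    (Set.range fun t : F => Submodule.span F {a + t * b}) (Set.range_nonempty _)
  refine ⟨t, ?_⟩
  have hmax : ∀ w, ¬ Submodule.span F {a + t * b} < Submodule.span F {a + t * b + w * b} := by
    intro w
    have := hI (Submodule.span F {a + (t + w) * b}) ⟨_, rfl⟩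
    rwa [add_mul, ← add_assoc] at this
  have hab' : d * (a + t * b) + (1 - d * t) * b = 1 := by
    rw [mul_add, sub_mul, one_mul, mul_assoc, add_add_sub_cancel, hab]
  clear hI
  generalize a + t * b = a' at hmax hab' ⊢
  -- `e = x * a'` is an idempotent generator of the left ideal of `a'`, so `a' * x * a' = a'`.
  obtain ⟨e, hee, he⟩ := IsSemisimpleRing.ideal_eq_span_idempotent (Submodule.span F {a'})
  obtain ⟨x, hx⟩ := Submodule.mem_span_singleton.1
    (show e ∈ Submodule.span F {a'} from he ▸ Ideal.mem_span_singleton_self e)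
  obtain ⟨z, hz⟩ := Submodule.mem_span_singleton.1
    (show a' ∈ Submodule.span F {e} from
      (he ▸ Submodule.mem_span_singleton_self a' : a' ∈ Ideal.span {e}))
  rw [smul_eq_mul] at hx hz
  have hae : a' * e = a' := by rw [← hz, mul_assoc, hee.eq]
  have hg : (1 - a' * x) * a' = 0 := by rw [sub_mul, one_mul, mul_assoc, hx, hae, sub_self]
  have hgg : (1 - a' * x) * (1 - a' * x) = 1 - a' * x := by
    rw [mul_sub, mul_one, ← mul_assoc, hg, zero_mul, sub_zero]
  -- `1 - a' * x` generates the kernel of right multiplication by `a'`, whose cokernel is isomorphic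
  -- to the left ideal of `1 - e`. A non-zero map from kernel to cokernel would enlarge the ideal.
  have key : ∀ y, (1 - a' * x) * y * (1 - e) = 0 := by
    intro y
    by_contra hne
    let g := 1 - a' * x
    let w := g * (y * (1 - d * t))
    have hyw : g * y * (1 - e) = w * b * (1 - e) := by
      have h1 : y * (1 - e) = y * (d * a' + (1 - d * t) * b) * (1 - e) := by rw [hab', mul_one]
      have h2 : a' * (1 - e) = 0 := by rw [mul_sub, mul_one, hae, sub_self]
      rw [mul_assoc g, h1, mul_add, add_mul, mul_assoc y (d * a'), mul_assoc d, h2]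
      simp only [mul_zero, zero_add, w, mul_assoc]
    have hgw : g * w = w := by simp only [w, ← mul_assoc]; rw [hgg]
    apply hmax w
    have hmem1 : a' ∈ Submodule.span F {a' + w * b} :=
      Submodule.mem_span_singleton.2 ⟨1 - g, by
        rw [smul_eq_mul, mul_add, ← mul_assoc, sub_mul 1 g w, hgw, sub_mul, hg]; simp⟩
    refine lt_of_le_of_ne ((Submodule.span_singleton_le_iff_mem _ _).2 hmem1) fun heq => hne ?_
    have hmem2 : w * b ∈ Submodule.span F {a'} := by
      rw [heq]
      refine Submodule.mem_span_singleton.2 ⟨g, ?_⟩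
      rw [smul_eq_mul, mul_add, hg, zero_add, ← mul_assoc, hgw]
    obtain ⟨c, hc⟩ := Submodule.mem_span_singleton.1 hmem2
    change g * y * (1 - e) = 0
    rw [hyw, ← hc, smul_eq_mul, mul_assoc, mul_sub, mul_one, hae, sub_self, mul_zero]
  -- Right multiplication by `a'` is surjective, hence injective, on the ideal of all `v` with
  -- `v * F * (1 - e) = 0`, which contains the left annihilator of `a'`.
  let J : Submodule F F :=
    { carrier := {v | ∀ y, v * y * (1 - e) = 0}
      add_mem' := fun {u v} hu hv y => by rw [add_mul, add_mul, hu, hv, add_zero]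
      zero_mem' := fun y => by simp
      smul_mem' := fun c v hv y => by
        rw [smul_eq_mul, mul_assoc, mul_assoc, ← mul_assoc v, hv, mul_zero] }
  have hJmul : ∀ v ∈ J, ∀ z, v * z ∈ J := fun v hv z y => by rw [mul_assoc v, hv]
  let φ : J →ₗ[F] J := (LinearMap.toSpanSingleton F F a').restrict fun v hv => by
    simpa using hJmul v hv a'
  have hφ : ∀ v : J, (φ v : F) = v * a' := fun v => rfl
  have hsurj : Function.Surjective φ := fun v => by
    refine ⟨⟨v * x, hJmul v v.2 x⟩, Subtype.ext ?_⟩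
    have := v.2 1
    rw [mul_one, mul_sub, mul_one, sub_eq_zero] at this
    rw [hφ, mul_assoc, hx, ← this]
  have hinj := IsNoetherian.injective_of_surjective_endomorphism φ hsurj
  have hg0 : 1 - a' * x = 0 := by
    have h : (⟨1 - a' * x, key⟩ : J) = 0 := hinj (Subtype.ext (by rw [hφ, map_zero]; exact hg))
    exact congrArg Subtype.val h
  have hax : a' * x = 1 := (sub_eq_zero.1 hg0).symm
  -- A right inverse in a Noetherian ring is two-sided.
  have hxinj : Function.Injective (LinearMap.toSpanSingleton F F x) :=
    IsNoetherian.injective_of_surjective_endomorphism _ fun y => ⟨y * a', by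
      simp [mul_assoc, hax]⟩
  have hxa : x * a' = 1 := hxinj (by simp [mul_assoc, hax])
  exact ⟨⟨a', x, hax, hxa⟩, rfl⟩

theorem HasStableRangeOne.of_surjective {E F : Type*} [Ring E] [Ring F] (φ : E →+* F)
    (hφ : Function.Surjective φ) (hloc : ∀ x, IsUnit (φ x) → IsUnit x)
    (hF : HasStableRangeOne F) : HasStableRangeOne E := by
  intro d a b h
  obtain ⟨t, ht⟩ := hF (φ d) (φ a) (φ b) (by rw [← map_mul, ← map_add, h, map_one])
  obtain ⟨t, rfl⟩ := hφ t
  exact ⟨t, hloc _ (by simpa using ht)⟩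

theorem IsArtinianRing.hasStableRangeOne (F : Type*) [Ring F] [IsArtinianRing F] :
    HasStableRangeOne F := by
  refine .of_surjective (Ideal.Quotient.mk (Ring.jacobson F)) Ideal.Quotient.mk_surjective ?_
    (IsSemisimpleRing.hasStableRangeOne (F ⧸ Ring.jacobson F))
  have hunit : ∀ y : F, Ideal.Quotient.mk (Ring.jacobson F) y = 1 → IsUnit y := by
    intro y hy
    obtain ⟨n, hn⟩ := IsSemiprimaryRing.isNilpotent (R := F)
    have hmem : y - 1 ∈ Ring.jacobson F := by
      rw [← Ideal.Quotient.eq_zero_iff_mem, map_sub, hy, map_one, sub_self]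
    have hnil : IsNilpotent (y - 1) := ⟨n, by
      have := Ideal.pow_mem_pow hmem n
      rwa [hn] at this⟩
    simpa using hnil.isUnit_add_one
  rintro x ⟨u, hu⟩
  obtain ⟨v, hv⟩ := Ideal.Quotient.mk_surjective (I := Ring.jacobson F) (↑u⁻¹)
  have h1 : IsUnit (x * v) := hunit _ (by rw [map_mul, hv, ← hu, Units.mul_inv])
  have h2 : IsUnit (v * x) := hunit _ (by rw [map_mul, hv, ← hu, Units.inv_mul])
  obtain ⟨y, hy⟩ := h1.exists_right_inv
  obtain ⟨z, hz⟩ := h2.exists_left_inv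
  rw [mul_assoc] at hy
  rw [← mul_assoc] at hz
  exact ⟨⟨x, v * y, hy, by rw [← left_inv_eq_right_inv hz hy, hz]⟩, rfl⟩

/-- Endomorphism rings of finitely generated modules over a local ring `C` have stable range one,
also those of modules over a `C`-algebra `U`: reduction modulo the maximal ideal
reflects units by Nakayama's lemma, and its image is a finite-dimensional algebra. -/
theorem Module.End.hasStableRangeOne (C U A : Type*) [CommRing C] [IsLocalRing C] [Ring U]
    [AddCommGroup A] [Module C A] [Module U A] [SMul C U] [IsScalarTower C U A]
    [SMulCommClass U C A] [Module.Finite C A] :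
    HasStableRangeOne (Module.End U A) := by
  let m := IsLocalRing.maximalIdeal C
  let mA : Submodule C A := m • ⊤
  have hle : ∀ e : Module.End U A, mA ≤ mA.comap (e.restrictScalars C) := fun e => by
    rw [← Submodule.map_le_iff_le_comap, Submodule.map_smul'']
    exact smul_mono_right _ le_top
  let ρ : Module.End U A →ₐ[C] Module.End C (A ⧸ mA) :=
    { toFun := fun e => mA.mapQ mA (e.restrictScalars C) (hle e)
      map_one' := by ext; rfl
      map_mul' := fun _ _ => by ext; rfl
      map_zero' := by ext; rfl
      map_add' := fun _ _ => by ext; rfl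
      commutes' := fun _ => by ext; rfl }
  have hρ : ∀ e x, ρ e (mA.mkQ x) = mA.mkQ (e x) := fun _ _ => rfl
  let _ : Field (C ⧸ m) := Ideal.Quotient.field m
  have hV : IsArtinian C (A ⧸ mA) := by
    have h1 : Module.Finite (C ⧸ m) (A ⧸ mA) := Module.Finite.of_restrictScalars_finite C _ _
    have h2 : IsArtinian (C ⧸ m) (A ⧸ mA) := inferInstance
    exact isArtinian_of_surjective_algebraMap (R := C ⧸ m) Ideal.Quotient.mk_surjective
  have hEnd : IsArtinian C (Module.End C (A ⧸ mA)) := by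
    obtain ⟨s, hs⟩ := Module.Finite.fg_top (R := C) (M := A ⧸ mA)
    let ev : Module.End C (A ⧸ mA) →ₗ[C] (s → A ⧸ mA) :=
      LinearMap.pi fun v => LinearMap.applyₗ (v : A ⧸ mA)
    refine isArtinian_of_injective ev fun f g hfg => ?_
    exact LinearMap.ext_on hs fun v hv => congrFun hfg ⟨v, hv⟩
  have hF : IsArtinianRing ρ.range := isArtinian_of_tower C
    (isArtinian_submodule' (Subalgebra.toSubmodule ρ.range) : IsArtinian C ρ.range)
  refine .of_surjective ρ.rangeRestrict.toRingHom ρ.rangeRestrict_surjective (fun e he => ?_)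
    (IsArtinianRing.hasStableRangeOne ρ.range)
  obtain ⟨⟨_, f, rfl⟩, hf⟩ := he.exists_right_inv
  have hf : ρ e * ρ f = 1 := congrArg Subtype.val hf
  have hsurj : Function.Surjective (e.restrictScalars C) := by
    rw [← LinearMap.range_eq_top]
    refine top_le_iff.1 (Submodule.le_of_le_smul_of_le_jacobson_bot (I := m)
      Module.Finite.fg_top (IsLocalRing.maximalIdeal_le_jacobson _) fun x _ => ?_)
    have hx : mA.mkQ (e (f x)) = mA.mkQ x := by
      rw [← hρ, ← hρ, ← Module.End.mul_apply, hf, Module.End.one_apply]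
    have hx' : x - e (f x) ∈ mA := (Submodule.Quotient.eq _).1 hx.symm
    rw [← add_sub_cancel (e (f x)) x]
    exact Submodule.add_mem_sup ⟨f x, rfl⟩ hx'
  have hbij : Function.Bijective e :=
    
    OrzechProperty.bijective_of_surjective_endomorphism (e.restrictScalars C) hsurj
  exact (Module.End.isUnit_iff e).2 hbij

/-- Evans' cancellation theorem: if two split epimorphisms `p`, `q` onto `A` have the same source
and `End A` has stable range one, their kernels are isomorphic. Here `K` and `L` are these kernels,
given through the splittings. -/
theorem HasStableRangeOne.nonempty_linearEquiv {U A H K L : Type*} [Ring U]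
    [AddCommGroup A] [Module U A] [AddCommGroup H] [Module U H] [AddCommGroup K] [Module U K]
    [AddCommGroup L] [Module U L] (hA : HasStableRangeOne (Module.End U A))
    {i j : A →ₗ[U] H} {p q : H →ₗ[U] A} {k : K →ₗ[U] H} {r : H →ₗ[U] K} {l : L →ₗ[U] H}
    {s : H →ₗ[U] L} (hpi : p ∘ₗ i = .id) (hrk : r ∘ₗ k = .id) (hp : i ∘ₗ p + k ∘ₗ r = .id)
    (hqj : q ∘ₗ j = .id) (hsl : s ∘ₗ l = .id) (hq : j ∘ₗ q + l ∘ₗ s = .id) :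
    Nonempty (K ≃ₗ[U] L) := by
  have hpi' : ∀ x, p (i x) = x := LinearMap.congr_fun hpi
  have hrk' : ∀ x, r (k x) = x := LinearMap.congr_fun hrk
  have hp' : ∀ x, i (p x) + k (r x) = x := LinearMap.congr_fun hp
  have hqj' : ∀ x, q (j x) = x := LinearMap.congr_fun hqj
  have hsl' : ∀ x, s (l x) = x := LinearMap.congr_fun hsl
  have hq' : ∀ x, j (q x) + l (s x) = x := LinearMap.congr_fun hq
  have hri : ∀ x, r (i x) = 0 := fun x => by
    have := congrArg r (hp' (i x))
    simpa [hpi', hrk'] using this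
  have hsj : ∀ x, s (j x) = 0 := fun x => by
    have := congrArg s (hq' (j x))
    simpa [hqj', hsl'] using this
  have hql : ∀ x, q (l x) = 0 := fun x => by
    have := congrArg q (hq' (l x))
    simpa [hqj', hsl'] using this
  have hpk : ∀ x, p (k x) = 0 := fun x => by
    have := congrArg p (hp' (k x))
    simpa [hpi', hrk'] using this
  obtain ⟨t, u, hu⟩ := hA (p ∘ₗ j) (q ∘ₗ i) (p ∘ₗ l ∘ₗ s ∘ₗ i) (by
    ext x
    have := congrArg p (hq' (i x))
    simpa [hpi'] using this)
  -- `q'` splits both `i`, up to the unit `u`, and `j`.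
  let q' : H →ₗ[U] A := q + t ∘ₗ p ∘ₗ l ∘ₗ s
  have hq'i : ∀ x, q' (i x) = (u : Module.End U A) x := fun x => by
    rw [hu]; rfl
  have hq'j : ∀ x, q' (j x) = x := fun x => by simp [q', hqj', hsj]
  let v : A →ₗ[U] A := (↑u⁻¹ : Module.End U A)
  have huv : ∀ x, (u : Module.End U A) (v x) = x := fun x =>
    LinearMap.congr_fun (Units.mul_inv u) x
  have hvu : ∀ x, v ((u : Module.End U A) x) = x := fun x =>
    LinearMap.congr_fun (Units.inv_mul u) x
  have hls : ∀ w, q' w = 0 → l (s w) - j (q' (l (s w))) = w := fun w hw => by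
    have h := hq' w
    have h1 : l (s w) = w - j (q w) := by rw [eq_sub_iff_add_eq, add_comm, h]
    have h2 : q' (l (s w)) = - q w := by rw [h1, map_sub, hw, hq'j, zero_sub]
    rw [h2, h1, map_neg]; abel
  have hkr : ∀ w, q' w = 0 → k (r w) - i (v (q' (k (r w)))) = w := fun w hw => by
    have h := hp' w
    have h1 : k (r w) = w - i (p w) := by rw [eq_sub_iff_add_eq, add_comm, h]
    have h2 : q' (k (r w)) = - (u : Module.End U A) (p w) := by
      rw [h1, map_sub, hw, hq'i, zero_sub]
    rw [h2, h1, map_neg, map_neg, hvu]; abel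
  refine ⟨LinearEquiv.ofLinearMap
    (s ∘ₗ (.id - i ∘ₗ v ∘ₗ q') ∘ₗ k) (r ∘ₗ (.id - j ∘ₗ q') ∘ₗ l) ?_ ?_⟩
  · ext y
    have := hkr (l y - j (q' (l y))) (by rw [map_sub, hq'j, sub_self])
    simp only [LinearMap.comp_apply, LinearMap.sub_apply, LinearMap.id_apply]
    rw [this, map_sub, hsl', hsj, sub_zero]
  · ext x
    have := hls (k x - i (v (q' (k x)))) (by rw [map_sub, hq'i, huv, sub_self])
    simp only [LinearMap.comp_apply, LinearMap.sub_apply, LinearMap.id_apply]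
    rw [this, map_sub, hrk', hri, sub_zero]

/-! ### Localization of linear maps between right modules -/

namespace LocalizedModule

variable {R : Type*} [CommRing R] (S : Submonoid R)
  {Λ : Type*} [Ring Λ] [Algebra R Λ]
  {M : Type*} [AddCommGroup M] [Module R M] [Module Λᵐᵒᵖ M] [IsScalarTower R Λᵐᵒᵖ M]
  {N : Type*} [AddCommGroup N] [Module R N] [Module Λᵐᵒᵖ N] [IsScalarTower R Λᵐᵒᵖ N]
  {P : Type*} [AddCommGroup P] [Module R P] [Module Λᵐᵒᵖ P] [IsScalarTower R Λᵐᵒᵖ P]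

theorem mk_add_mk_right (x y : M) (s : S) :
    (mk x s + mk y s : LocalizedModule S M) = mk (x + y) s :=
  OreLocalization.add_oreDiv

/-- The localization `x / s ↦ f x / s` of a linear map of right `Λ`-modules. -/
noncomputable def rightMap (f : M →ₗ[Λᵐᵒᵖ] N) :
    LocalizedModule S M →ₗ[(LocalizedModule S Λ)ᵐᵒᵖ] LocalizedModule S N where
  toFun := LocalizedModule.map S (f.restrictScalars R)
  map_add' := map_add _
  map_smul' b y := by
    induction b using MulOpposite.rec' with | _ b
    induction b with | _ b t
    induction y with | _ x s
    simp [op_mk_smul_mk]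

@[simp]
theorem rightMap_mk (f : M →ₗ[Λᵐᵒᵖ] N) (x : M) (s : S) : rightMap S f (mk x s) = mk (f x) s :=
  IsLocalizedModule.map_LocalizedModules _ _ _ _

theorem rightMap_id : rightMap S (.id : M →ₗ[Λᵐᵒᵖ] M) = .id := by
  ext y; induction y; simp

theorem rightMap_comp (g : N →ₗ[Λᵐᵒᵖ] P) (f : M →ₗ[Λᵐᵒᵖ] N) :
    rightMap S (g ∘ₗ f) = rightMap S g ∘ₗ rightMap S f := by
  ext y; induction y; simp

theorem rightMap_add (f g : M →ₗ[Λᵐᵒᵖ] N) :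
    rightMap S (f + g) = rightMap S f + rightMap S g := by
  ext y; induction y; simp

instance : IsScalarTower R (LocalizedModule S Λ)ᵐᵒᵖ (LocalizedModule S M) where
  smul_assoc r b y := by
    induction b using MulOpposite.rec' with | _ b
    induction b with | _ b t
    induction y with | _ x s
    rw [← MulOpposite.op_smul, smul'_mk, op_mk_smul_mk, op_mk_smul_mk, smul'_mk,
      MulOpposite.op_smul, smul_assoc]

instance : IsScalarTower (Localization S) (LocalizedModule S Λ)ᵐᵒᵖ (LocalizedModule S M) where
  smul_assoc r b y := by
    induction b using MulOpposite.rec' with | _ b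
    induction b with | _ b t
    induction y with | _ x s
    induction r with | _ r
    rw [← MulOpposite.op_smul, mk_smul_mk, op_mk_smul_mk, op_mk_smul_mk, mk_smul_mk,
      MulOpposite.op_smul, smul_assoc, mul_left_comm]

instance : SMulCommClass (LocalizedModule S Λ)ᵐᵒᵖ (Localization S) (LocalizedModule S M) where
  smul_comm b r y := by
    induction b using MulOpposite.rec' with | _ b
    induction b with | _ b t
    induction y with | _ x s
    induction r with | _ r
    rw [op_mk_smul_mk, mk_smul_mk, mk_smul_mk, op_mk_smul_mk, smul_comm, mul_assoc]

theorem mk_one_injective [IsDomain R] [Module.IsTorsionFree R M] (hS : S ≤ nonZeroDivisors R) :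
    Function.Injective fun x : M => (mk x 1 : LocalizedModule S M) := by
  intro x y h
  obtain ⟨u, hu⟩ := mk_eq.1 h
  simp only [one_smul, Submonoid.smul_def] at hu
  exact smul_right_injective M (nonZeroDivisors.ne_zero (hS u.2)) hu

/-- A homomorphism of localizations comes, up to a denominator, from a homomorphism of the modules,
if the source is finitely generated and the target torsion-free. -/
theorem exists_rightMap_eq_smul [IsDomain R] [Module.IsTorsionFree R N]
    (hS : S ≤ nonZeroDivisors R) [Module.Finite Λᵐᵒᵖ M]
    (h : LocalizedModule S M →ₗ[(LocalizedModule S Λ)ᵐᵒᵖ] LocalizedModule S N) :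
    ∃ (s : S) (f : M →ₗ[Λᵐᵒᵖ] N), ∀ y, rightMap S f y = (s : R) • h y := by
  have hinj := mk_one_injective (M := N) S hS
  have hop : ∀ (a : Λ) (x : M), h (mk (MulOpposite.op a • x) 1) =
      MulOpposite.op (mk a 1 : LocalizedModule S Λ) • h (mk x 1) := fun a x => by
    rw [← map_smul, op_mk_smul_mk, one_mul]
  -- One `s` clears the denominators of all values of `h` on `M`, as it does so on generators.
  have key : ∃ s : S, ∀ x, ∃ y : N, mk y 1 = (s : R) • h (mk x 1) := by
    obtain ⟨t, ht⟩ := Module.Finite.fg_top (R := Λᵐᵒᵖ) (M := M)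
    have hden : ∀ x : M, ∃ s : S, ∃ y : N, mk y 1 = (s : R) • h (mk x 1) := fun x => by
      generalize h (mk x 1) = z
      induction z with | _ y s
      exact ⟨s, y, by rw [smul'_mk]; exact (mk_cancel s y).symm⟩
    choose s hs using hden
    refine ⟨∏ x ∈ t, s x, fun x => ?_⟩
    have hx : x ∈ Submodule.span Λᵐᵒᵖ (t : Set M) := ht ▸ Submodule.mem_top
    induction hx using Submodule.span_induction with
    | mem x hx =>
      obtain ⟨y, hy⟩ := hs x
      classical
      refine ⟨((∏ x ∈ t.erase x, s x : S) : R) • y, ?_⟩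
      rw [← smul'_mk, hy, smul_smul, ← Submonoid.coe_mul, Finset.prod_erase_mul _ _ hx]
    | zero => exact ⟨0, by rw [zero_mk, zero_mk, map_zero, smul_zero]⟩
    | add x x' _ _ hx hx' =>
      obtain ⟨y, hy⟩ := hx
      obtain ⟨y', hy'⟩ := hx'
      exact ⟨y + y', by rw [← mk_add_mk_right, hy, hy', ← mk_add_mk_right, map_add, smul_add]⟩
    | smul a x _ hx =>
      obtain ⟨y, hy⟩ := hx
      induction a using MulOpposite.rec' with | _ a
      refine ⟨MulOpposite.op a • y, ?_⟩
      rw [hop, smul_comm, ← hy, op_mk_smul_mk, one_mul]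
  obtain ⟨s, hs⟩ := key
  choose f hf using hs
  refine ⟨s, ⟨⟨f, fun x y => hinj ?_⟩, fun a x => hinj ?_⟩, fun y => ?_⟩
  · beta_reduce
    rw [hf, ← mk_add_mk_right, ← mk_add_mk_right, hf, hf, map_add, smul_add]
  · induction a using MulOpposite.rec' with | _ a
    beta_reduce
    have h1 : (mk (MulOpposite.op a • f x) 1 : LocalizedModule S N) =
      MulOpposite.op (mk a 1 : LocalizedModule S Λ) • mk (f x) 1 := by
      rw [op_mk_smul_mk, one_mul]
    simp only [RingHom.id_apply]
    rw [h1, hf, hf, hop, smul_comm]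
  · induction y with | _ x t
    have ht : (mk x t : LocalizedModule S M) =
        MulOpposite.op (mk 1 t : LocalizedModule S Λ) • mk x 1 := by
      rw [op_mk_smul_mk, one_mul, MulOpposite.op_one, one_smul]
    rw [ht, map_smul, map_smul, smul_comm, rightMap_mk, LinearMap.coe_mk, AddHom.coe_mk, hf]

/-- Localizations at a prime of finitely generated modules over a finite `R`-algebra have
endomorphism rings of stable range one. -/
theorem hasStableRangeOne_end_atPrime (m : Ideal R) [m.IsPrime] [Module.Finite R M] :
    HasStableRangeOne (Module.End (LocalizedModule m.primeCompl Λ)ᵐᵒᵖ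
      (LocalizedModule m.primeCompl M)) :=
  Module.End.hasStableRangeOne (Localization m.primeCompl) _ _

/-- If `M = X ⊕ K` and `N = Y ⊕ L` with `X ≅ Y` finitely generated, an isomorphism of the
localizations of `M` and `N` at a prime yields one of the localizations of `K` and `L`. -/
theorem nonempty_linearEquiv_ker_atPrime (m : Ideal R) [m.IsPrime]
    {X : Type*} [AddCommGroup X] [Module R X] [Module Λᵐᵒᵖ X] [IsScalarTower R Λᵐᵒᵖ X]
    [Module.Finite R X] {i : X →ₗ[Λᵐᵒᵖ] M} {p : M →ₗ[Λᵐᵒᵖ] X} (hp : p ∘ₗ i = .id)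
    {j : X →ₗ[Λᵐᵒᵖ] N} {q : N →ₗ[Λᵐᵒᵖ] X} (hq : q ∘ₗ j = .id)
    (φ : LocalizedModule m.primeCompl M ≃ₗ[(LocalizedModule m.primeCompl Λ)ᵐᵒᵖ]
      LocalizedModule m.primeCompl N) :
    Nonempty (LocalizedModule m.primeCompl (LinearMap.ker p)
      ≃ₗ[(LocalizedModule m.primeCompl Λ)ᵐᵒᵖ] LocalizedModule m.primeCompl (LinearMap.ker q)) := by
  have hp' : ∀ x, p (i x) = x := LinearMap.congr_fun hp
  have hq' : ∀ x, q (j x) = x := LinearMap.congr_fun hq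
  let r : M →ₗ[Λᵐᵒᵖ] LinearMap.ker p := (LinearMap.id - i ∘ₗ p).codRestrict _ fun x => by simp [hp']
  let s : N →ₗ[Λᵐᵒᵖ] LinearMap.ker q := (LinearMap.id - j ∘ₗ q).codRestrict _ fun x => by simp [hq']
  have hr : r ∘ₗ (LinearMap.ker p).subtype = .id := by
    ext ⟨x, hx⟩; simp [r, LinearMap.mem_ker.1 hx]
  have hs : s ∘ₗ (LinearMap.ker q).subtype = .id := by
    ext ⟨x, hx⟩; simp [s, LinearMap.mem_ker.1 hx]
  have hpr : i ∘ₗ p + (LinearMap.ker p).subtype ∘ₗ r = .id := by ext x; simp [r]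
  have hqs : j ∘ₗ q + (LinearMap.ker q).subtype ∘ₗ s = .id := by ext x; simp [s]
  have hX := hasStableRangeOne_end_atPrime (Λ := Λ) (M := X) m
  generalize m.primeCompl = S at φ hX ⊢
  have h := congrArg (rightMap S) hp
  have h1 := congrArg (rightMap S) hr
  have h2 := congrArg (rightMap S) hpr
  have h3 := congrArg (rightMap S) hq
  have h4 := congrArg (rightMap S) hs
  have h5 := congrArg (rightMap S) hqs
  simp only [rightMap_comp, rightMap_add, rightMap_id] at h h1 h2 h3 h4 h5
  refine hX.nonempty_linearEquiv (i := φ.toLinearMap ∘ₗ rightMap S i)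
    (p := rightMap S p ∘ₗ φ.symm.toLinearMap)
    (k := φ.toLinearMap ∘ₗ rightMap S (LinearMap.ker p).subtype)
    (r := rightMap S r ∘ₗ φ.symm.toLinearMap) ?_ ?_ ?_ h3 h4 h5
  · ext x; simpa using LinearMap.congr_fun h x
  · ext x; simpa using LinearMap.congr_fun h1 x
  · ext x; simpa using congrArg φ (LinearMap.congr_fun h2 (φ.symm x))

end LocalizedModule

/-! ### Genera -/

theorem Module.Finite.of_mulOpposite {R : Type*} [CommRing R] (Λ : Type*) [Ring Λ] [Algebra R Λ]
    [Module.Finite R Λ] (X : Type*) [AddCommGroup X] [Module R X]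
    [Module Λᵐᵒᵖ X] [IsScalarTower R Λᵐᵒᵖ X] [Module.Finite Λᵐᵒᵖ X] : Module.Finite R X :=
  have : Module.Finite R Λᵐᵒᵖ := .equiv (MulOpposite.opLinearEquiv R)
  .trans Λᵐᵒᵖ X

namespace InSameGenus
variable {R : Type*} [CommRing R] {Λ : Type*} [Ring Λ] [Algebra R Λ]
  {M : Type*} [AddCommGroup M] [Module R M] [Module Λᵐᵒᵖ M] [IsScalarTower R Λᵐᵒᵖ M]
  {N : Type*} [AddCommGroup N] [Module R N] [Module Λᵐᵒᵖ N] [IsScalarTower R Λᵐᵒᵖ N]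
  {P : Type*} [AddCommGroup P] [Module R P] [Module Λᵐᵒᵖ P] [IsScalarTower R Λᵐᵒᵖ P]

theorem symm (h : InSameGenus R Λ M N) : InSameGenus R Λ N M := fun m => ⟨(h m).some.symm⟩

theorem trans (h : InSameGenus R Λ M N) (h' : InSameGenus R Λ N P) : InSameGenus R Λ M P :=
  fun m => ⟨(h m).some.trans (h' m).some⟩

theorem of_linearEquiv (e : M ≃ₗ[Λᵐᵒᵖ] N) : InSameGenus R Λ M N := fun m =>
  ⟨LinearEquiv.ofLinearMap (LocalizedModule.rightMap _ e.toLinearMap)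
    (LocalizedModule.rightMap _ e.symm.toLinearMap)
    (by rw [← LocalizedModule.rightMap_comp, LinearEquiv.comp_symm, LocalizedModule.rightMap_id])
    (by rw [← LocalizedModule.rightMap_comp, LinearEquiv.symm_comp, LocalizedModule.rightMap_id])⟩

theorem ker [Module.Finite R Λ] (hgenus : InSameGenus R Λ M N) [Module.Finite Λᵐᵒᵖ P]
    {i : P →ₗ[Λᵐᵒᵖ] M} {p : M →ₗ[Λᵐᵒᵖ] P} (hp : p ∘ₗ i = .id)
    {j : P →ₗ[Λᵐᵒᵖ] N} {q : N →ₗ[Λᵐᵒᵖ] P} (hq : q ∘ₗ j = .id) :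
    InSameGenus R Λ (LinearMap.ker p) (LinearMap.ker q) := fun m =>
  have := m.isMaximal.isPrime
  have : Module.Finite R P := .of_mulOpposite Λ P
  LocalizedModule.nonempty_linearEquiv_ker_atPrime m.asIdeal hp hq (hgenus m).some

end InSameGenus

/-! ### Patching local splittings at finitely many maximal ideals -/

section Patching

variable {R : Type*} [CommRing R]

/-- An endomorphism of a finitely generated torsion-free module which modulo each of the maximal
ideals in a finite set is a non-zero scalar becomes, after multiplication by another endomorphism,
a scalar outside all of these ideals. -/
theorem Module.End.exists_mul_eq_smul_of_finset [IsDomain R] {T X : Type*} [Ring T] [Algebra R T]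
    [AddCommGroup X] [Module R X] [Module T X] [IsScalarTower R T X] [Module.Finite R X]
    [Module.IsTorsionFree R X] (S : Finset (MaximalSpectrum R)) (e : X →ₗ[T] X)
    (he : ∀ m ∈ S, ∃ c ∉ m.asIdeal, ∀ x, e x - c • x ∈ m.asIdeal • (⊤ : Submodule R X)) :
    ∃ (d : X →ₗ[T] X) (s : R), (∀ m ∈ S, s ∉ m.asIdeal) ∧ ∀ x, d (e x) = s • x := by
  rcases S.eq_empty_or_nonempty with rfl | hne
  · exact ⟨0, 0, by simp, by simp⟩
  let W : Submodule R X := LinearMap.range (e.restrictScalars R)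
  -- By Nakayama's lemma the annihilator of the cokernel of `e` lies in none of the ideals.
  have hann : ∀ m ∈ S, ¬ Module.annihilator R (X ⧸ W) ≤ m.asIdeal := by
    intro m hm hle
    obtain ⟨c, hc, hec⟩ := he m hm
    obtain ⟨y, hy⟩ := m.isMaximal.exists_inv hc
    obtain ⟨z, hz, hyz⟩ := hy
    have hle' : (⊤ : Submodule R X) ≤ W ⊔ m.asIdeal • ⊤ := by
      rintro x -
      have hx : x = e (y • x) + (z • x - y • (e x - c • x)) := by
        have : (y * c + z) • x = x := by rw [hyz, one_smul]
        rw [LinearMap.map_smul_of_tower, smul_sub, smul_smul]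
        nth_rw 1 [← this, add_smul]
        abel
      rw [hx]
      exact Submodule.add_mem_sup ⟨y • x, rfl⟩ (Submodule.sub_mem _
        (Submodule.smul_mem_smul hz trivial) (Submodule.smul_mem _ _ (hec x)))
    obtain ⟨r, hr, hr0⟩ := Submodule.exists_sub_one_mem_and_smul_le_of_fg_of_le_sup
      Module.Finite.fg_top le_rfl hle'
    have hrm : r ∈ m.asIdeal := hle (Module.mem_annihilator.2 fun w => by
      obtain ⟨x, rfl⟩ := W.mkQ_surjective w
      rw [← map_smul, Submodule.mkQ_apply, Submodule.Quotient.mk_eq_zero]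
      exact hr0 (Submodule.smul_mem_pointwise_smul x r ⊤ trivial))
    exact m.isMaximal.ne_top ((Ideal.eq_top_iff_one _).2 (by simpa using sub_mem hrm hr))
  obtain ⟨s, hsann, hs⟩ : ∃ s ∈ Module.annihilator R (X ⧸ W), ∀ m ∈ S, s ∉ m.asIdeal := by
    by_contra! hcon
    obtain ⟨m, hm, hle⟩ := (Ideal.subset_union_prime (R := R) (s := S)
      (f := fun m => m.asIdeal) hne.choose hne.choose
      (fun m _ _ _ => m.isMaximal.isPrime) (I := Module.annihilator R (X ⧸ W))).1 (by
        intro s hs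
        obtain ⟨m, hm, hsm⟩ := hcon s hs
        exact Set.mem_biUnion hm hsm)
    exact hann m hm hle
  have hs0 : s ≠ 0 := by
    rintro rfl
    obtain ⟨m, hm⟩ := hne
    exact hs m hm (zero_mem _)
  have hsW : ∀ x, ∃ y, e y = s • x := fun x => by
    have := Module.mem_annihilator.1 hsann (W.mkQ x)
    rw [← map_smul, Submodule.mkQ_apply, Submodule.Quotient.mk_eq_zero] at this
    exact this
  have hsinj : Function.Injective fun x : X => s • x := smul_right_injective X hs0
  -- The preimage of `s X` under `e` surjects onto `X`, so `e` is injective.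
  have heinj : Function.Injective e := by
    let sX : X →ₗ[R] X := LinearMap.lsmul R X s
    let L := LinearEquiv.ofInjective sX hsinj
    let Z : Submodule R X := (LinearMap.range sX).comap (e.restrictScalars R)
    let ψ : Z →ₗ[R] X := L.symm.toLinearMap ∘ₗ
      ((e.restrictScalars R).restrict (fun x hx => hx) : Z →ₗ[R] LinearMap.range sX)
    have hψ : ∀ z, s • ψ z = e z := fun z => by
      have := congrArg Subtype.val (L.apply_symm_apply (⟨e z, z.2⟩ : LinearMap.range sX))
      exact this
    have hinj : Function.Injective ψ :=
      OrzechProperty.injective_of_surjective_of_submodule ψ fun x => by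
        obtain ⟨y, hy⟩ := hsW x
        exact ⟨⟨y, x, hy.symm⟩, hsinj (by simp only [hψ]; exact hy)⟩
    refine (injective_iff_map_eq_zero e).2 fun x hx => ?_
    have : (⟨x, 0, by simp [hx]⟩ : Z) = 0 := hinj (hsinj (by simp only [hψ, map_zero]; simp [hx]))
    exact congrArg Subtype.val this
  choose d hd using hsW
  refine ⟨⟨⟨d, fun x y => heinj ?_⟩, fun a x => heinj ?_⟩, s, hs, fun x => heinj (hd _ |>.trans ?_)⟩
  · rw [map_add, hd, hd, hd, smul_add]
  · simp only [RingHom.id_apply]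
    rw [map_smul, hd, hd, smul_comm]
  · rw [LinearMap.map_smul_of_tower]

/-- Linear maps `X → Y → X` whose composites are scalars `s ∉ m`, given for each `m` in a finite
set of maximal ideals, can be replaced by a single pair: take linear combinations with coefficients
from the Chinese remainder theorem. -/
theorem LinearMap.exists_comp_eq_smul_of_finset [IsDomain R] {T X Y : Type*} [Ring T] [Algebra R T]
    [AddCommGroup X] [Module R X] [Module T X] [IsScalarTower R T X] [Module.Finite R X]
    [Module.IsTorsionFree R X] [AddCommGroup Y] [Module R Y] [Module T Y] [IsScalarTower R T Y]
    (S : Finset (MaximalSpectrum R))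
    (h : ∀ m ∈ S, ∃ (f : X →ₗ[T] Y) (g : Y →ₗ[T] X), ∃ s ∉ m.asIdeal, ∀ x, g (f x) = s • x) :
    ∃ (f : X →ₗ[T] Y) (g : Y →ₗ[T] X) (s : R), (∀ m ∈ S, s ∉ m.asIdeal) ∧
      ∀ x, g (f x) = s • x := by
  classical
  have hc : ∀ m : MaximalSpectrum R, ∃ c ∉ m.asIdeal, ∀ n ∈ S, n ≠ m → c ∈ n.asIdeal := by
    intro m
    have : ∀ n : MaximalSpectrum R, ∃ c ∉ m.asIdeal, n ≠ m → c ∈ n.asIdeal := fun n => by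
      by_cases hnm : n = m
      · exact ⟨1, (Ideal.ne_top_iff_one _).1 m.isMaximal.ne_top, fun h => absurd hnm h⟩
      · have : ¬ n.asIdeal ≤ m.asIdeal := fun hle =>
          hnm (MaximalSpectrum.ext (n.isMaximal.eq_of_le m.isMaximal.ne_top hle))
        obtain ⟨c, hc, hcm⟩ := SetLike.not_le_iff_exists.1 this
        exact ⟨c, hcm, fun _ => hc⟩
    choose c hc hc' using this
    have := m.isMaximal.isPrime
    refine ⟨∏ n ∈ S, c n, fun hmem => ?_, fun n hn hnm => ?_⟩
    · obtain ⟨n, -, hn⟩ := (Ideal.IsPrime.prod_mem_iff).1 hmem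
      exact hc n hn
    · exact Ideal.mem_of_dvd _ (Finset.dvd_prod_of_mem c hn) (hc' n hnm)
  choose c hc hc' using hc
  have h' : ∀ m : MaximalSpectrum R, ∃ (f : X →ₗ[T] Y) (g : Y →ₗ[T] X) (s : R), m ∈ S →
      s ∉ m.asIdeal ∧ ∀ x, g (f x) = s • x := fun m => by
    by_cases hm : m ∈ S
    · obtain ⟨f, g, s, hs, hgf⟩ := h m hm
      exact ⟨f, g, s, fun _ => ⟨hs, hgf⟩⟩
    · exact ⟨0, 0, 0, fun h => absurd h hm⟩
  choose f g s hs using h'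
  let F : X →ₗ[T] Y := ∑ m ∈ S, c m • f m
  let G : Y →ₗ[T] X := ∑ m ∈ S, c m • g m
  obtain ⟨d, r, hr, hd⟩ := Module.End.exists_mul_eq_smul_of_finset S (G ∘ₗ F) fun m hm => by
    have := m.isMaximal.isPrime
    refine ⟨c m * (c m * s m), ?_, fun x => ?_⟩
    · rw [this.mul_mem_iff_mem_or_mem, this.mul_mem_iff_mem_or_mem]
      have := hc m
      have := (hs m hm).1
      tauto
    -- Modulo `m` only the `m`-th summands of `F` and `G` survive.
    have hmem : ∀ n ∈ S.erase m, ∀ y : X, c n • y ∈ m.asIdeal • (⊤ : Submodule R X) := fun n hn y =>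
      Submodule.smul_mem_smul (hc' n m hm (Finset.ne_of_mem_erase hn).symm) trivial
    have hG : ∀ y, G y - c m • g m y ∈ m.asIdeal • (⊤ : Submodule R X) := fun y => by
      simp only [G]
      rw [← Finset.add_sum_erase _ _ hm, LinearMap.add_apply, LinearMap.smul_apply,
        add_sub_cancel_left, LinearMap.sum_apply]
      exact Submodule.sum_mem _ fun n hn => hmem n hn _
    have hF : g m (F x) - c m • s m • x ∈ m.asIdeal • (⊤ : Submodule R X) := by
      simp only [F]
      rw [← Finset.add_sum_erase _ _ hm, LinearMap.add_apply, LinearMap.smul_apply, map_add,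
        LinearMap.map_smul_of_tower, (hs m hm).2, add_sub_cancel_left, LinearMap.sum_apply, map_sum]
      refine Submodule.sum_mem _ fun n hn => ?_
      rw [LinearMap.smul_apply, LinearMap.map_smul_of_tower]
      exact hmem n hn _
    have := Submodule.add_mem _ (hG (F x)) (Submodule.smul_mem _ (c m) hF)
    rwa [smul_sub, sub_add_sub_cancel, smul_smul, smul_smul, mul_assoc] at this
  exact ⟨F, d ∘ₗ G, r, hr, hd⟩

end Patching

/-! ### Rational embeddings over simple artinian rings -/

/-- Over a simple artinian ring, a finitely generated module is a direct summand of the sum of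
sufficiently many non-zero modules, as each of these contains the unique simple module. -/
theorem IsSimpleRing.exists_sum_comp_eq_id (U : Type*) [Ring U] [IsSimpleRing U] [IsArtinianRing U]
    (W : Type*) [AddCommGroup W] [Module U W] [Module.Finite U W]
    (V : ℕ → Type*) [∀ j, AddCommGroup (V j)] [∀ j, Module U (V j)] [∀ j, Nontrivial (V j)] :
    ∃ (n : ℕ) (α : ∀ j, W →ₗ[U] V j) (β : ∀ j, V j →ₗ[U] W),
      ∑ j ∈ Finset.range n, β j ∘ₗ α j = .id := by
  cases subsingleton_or_nontrivial W
  · exact ⟨0, fun _ => 0, fun _ => 0, Subsingleton.elim _ _⟩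
  obtain ⟨n, -, S, hS, ⟨e⟩⟩ := (IsSimpleRing.isIsotypic U W).linearEquiv_fun
  -- The simple module `S` is a direct summand of every `V j`.
  have hret : ∀ j, ∃ (ι : S →ₗ[U] V j) (ρ : V j →ₗ[U] S), ρ ∘ₗ ι = .id := by
    intro j
    obtain ⟨T, hT⟩ := IsAtomic.exists_atom (Submodule U (V j))
    rw [← isSimpleModule_iff_isAtom] at hT
    let eS := S.equivMapOfInjective (LinearMap.inl U W (V j)) LinearMap.inl_injective
    let eT := T.equivMapOfInjective (LinearMap.inr U W (V j)) LinearMap.inr_injective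
    have := IsSimpleModule.congr eS.symm
    have := IsSimpleModule.congr eT.symm
    obtain ⟨f⟩ := IsSimpleRing.isIsotypic U (W × V j) (T.map (LinearMap.inr U W (V j)))
      (S.map (LinearMap.inl U W (V j)))
    let ι : S →ₗ[U] V j := T.subtype ∘ₗ ((eS.trans f).trans eT.symm).toLinearMap
    have hι : Function.Injective ι := T.subtype_injective.comp (LinearEquiv.injective _)
    obtain ⟨ρ, hρ⟩ := IsSemisimpleModule.extension_property ι hι .id
    exact ⟨ι, ρ, hρ⟩
  choose ι ρ hρ using hret
  refine ⟨n, fun j => if h : j < n then ι j ∘ₗ LinearMap.proj ⟨j, h⟩ ∘ₗ e.toLinearMap else 0,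
    fun j => if h : j < n then e.symm.toLinearMap ∘ₗ LinearMap.single U (fun _ => S) ⟨j, h⟩ ∘ₗ ρ j
      else 0, ?_⟩
  rw [Finset.sum_range]
  ext x
  apply e.injective
  have hρ' : ∀ j y, ρ j (ι j y) = y := fun j => LinearMap.congr_fun (hρ j)
  simpa [hρ', LinearMap.sum_apply] using Finset.univ_sum_single (e x)

section Order

variable {R : Type*} [CommRing R] (Q : Type*) [Field Q] [Algebra R Q] [IsFractionRing R Q]
  (Λ : Type*) [Ring Λ] [Algebra R Λ]

/-- Inverting all non-zero elements of `R` in `Λ` amounts to tensoring with the fraction field. -/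
noncomputable def LocalizedModule.ringEquivTensor :
    LocalizedModule (nonZeroDivisors R) Λ ≃+* Λ ⊗[R] Q :=
  let f : Λ →ₗ[R] Λ ⊗[R] Q := (TensorProduct.comm R Q Λ).toLinearMap ∘ₗ TensorProduct.mk R Q Λ 1
  { IsLocalizedModule.iso (nonZeroDivisors R) f with
    map_mul' := fun x y => by
      have hf : ∀ a : Λ, f a = a ⊗ₜ 1 := fun a => rfl
      have hunit : ∀ s : nonZeroDivisors R, IsUnit (algebraMap R (Λ ⊗[R] Q) s) := fun s => by
        have := (IsLocalization.map_units Q s).map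
          (Algebra.TensorProduct.includeRight : Q →ₐ[R] Λ ⊗[R] Q)
        rwa [AlgHom.commutes] at this
      have hmk : ∀ (a : Λ) (s : nonZeroDivisors R),
          algebraMap R (Λ ⊗[R] Q) s * IsLocalizedModule.iso (nonZeroDivisors R) f (.mk a s) =
            a ⊗ₜ 1 := fun a s => by
        rw [← Algebra.smul_def, ← map_smul, LocalizedModule.smul'_mk, ← hf,
          ← IsLocalizedModule.iso_mk_one (nonZeroDivisors R) f, ← LocalizedModule.mk_cancel s]
        rfl
      induction x with | _ a s
      induction y with | _ b t
      change IsLocalizedModule.iso (nonZeroDivisors R) f _ =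
        IsLocalizedModule.iso (nonZeroDivisors R) f _ * IsLocalizedModule.iso (nonZeroDivisors R) f _
      rw [LocalizedModule.mk_mul_mk]
      apply (hunit (s * t)).mul_left_cancel
      rw [hmk, Submonoid.coe_mul, map_mul, mul_assoc, ← mul_assoc _ (IsLocalizedModule.iso _ f _),
        Algebra.commutes (t : R) (IsLocalizedModule.iso _ f _), mul_assoc, hmk, ← mul_assoc, hmk,
        Algebra.TensorProduct.tmul_mul_tmul, mul_one] }

variable {Λ}

instance LocalizedModule.finite_rightModule (S : Submonoid R) {X : Type*} [AddCommGroup X]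
    [Module R X] [Module Λᵐᵒᵖ X] [IsScalarTower R Λᵐᵒᵖ X] [Module.Finite R X] :
    Module.Finite (LocalizedModule S Λ)ᵐᵒᵖ (LocalizedModule S X) :=
  .of_restrictScalars_finite (Localization S) _ _

/-- A finitely generated torsion-free module is, up to a non-zero scalar, a direct summand of the
sum of sufficiently many non-zero torsion-free modules, as this holds over the simple artinian ring
`Λ ⊗ Q`. -/
theorem exists_sum_comp_eq_smul [IsDomain R] [Module.Finite R Λ] (hsimple : IsSimpleRing (Λ ⊗[R] Q))
    (hartinian : IsArtinianRing (Λ ⊗[R] Q)) (X : Type*) [AddCommGroup X] [Module R X]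
    [Module Λᵐᵒᵖ X] [IsScalarTower R Λᵐᵒᵖ X] [Module.Finite Λᵐᵒᵖ X] [Module.IsTorsionFree R X]
    (V : ℕ → Type*) [∀ j, AddCommGroup (V j)] [∀ j, Module R (V j)] [∀ j, Module Λᵐᵒᵖ (V j)]
    [∀ j, IsScalarTower R Λᵐᵒᵖ (V j)] [∀ j, Module.Finite Λᵐᵒᵖ (V j)]
    [∀ j, Module.IsTorsionFree R (V j)] [∀ j, Nontrivial (V j)] :
    ∃ (n : ℕ) (f : ∀ j, X →ₗ[Λᵐᵒᵖ] V j) (g : ∀ j, V j →ₗ[Λᵐᵒᵖ] X) (r : R), r ≠ 0 ∧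
      ∀ x, ∑ j ∈ Finset.range n, g j (f j x) = r • x := by
  let S := nonZeroDivisors R
  let e : LocalizedModule S Λ ≃+* Λ ⊗[R] Q := LocalizedModule.ringEquivTensor Q Λ
  have : IsSimpleRing (LocalizedModule S Λ) := .of_ringEquiv e.symm hsimple
  have : IsArtinianRing (LocalizedModule S Λ) := e.symm.isArtinianRing
  have : IsSemisimpleRing (LocalizedModule S Λ)ᵐᵒᵖ := inferInstance
  have : IsArtinianRing (LocalizedModule S Λ)ᵐᵒᵖ := inferInstance
  have : Module.Finite R X := .of_mulOpposite Λ X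
  have hinj := LocalizedModule.mk_one_injective (M := X) S le_rfl
  have : ∀ j, Nontrivial (LocalizedModule S (V j)) := fun j =>
    (LocalizedModule.mk_one_injective (M := V j) S le_rfl).nontrivial
  obtain ⟨n, α, β, h⟩ := IsSimpleRing.exists_sum_comp_eq_id (LocalizedModule S Λ)ᵐᵒᵖ
    (LocalizedModule S X) fun j => LocalizedModule S (V j)
  choose s f hf using fun j => LocalizedModule.exists_rightMap_eq_smul S le_rfl (α j)
  choose t g hg using fun j => LocalizedModule.exists_rightMap_eq_smul S le_rfl (β j)
  let r : S := ∏ j ∈ Finset.range n, (t j * s j)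
  let c : ℕ → R := fun j => (∏ k ∈ (Finset.range n).erase j, (t k * s k) : S)
  refine ⟨n, f, fun j => c j • g j, r, nonZeroDivisors.ne_zero r.2, fun x => hinj ?_⟩
  have hterm : ∀ j ∈ Finset.range n, (LocalizedModule.mk (c j • g j (f j x)) 1 :
      LocalizedModule S X) = (r : R) • β j (α j (LocalizedModule.mk x 1)) := fun j hj => by
    rw [← LocalizedModule.smul'_mk, ← LocalizedModule.rightMap_mk, ← LocalizedModule.rightMap_mk,
      hf, LinearMap.map_smul_of_tower, hg, smul_smul, smul_smul]
    congr 1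
    simp only [c, r, ← Finset.prod_erase_mul _ _ hj, Submonoid.coe_mul]
    ring
  have hsum := LinearMap.congr_fun h (LocalizedModule.mk x 1)
  simp only [LinearMap.sum_apply, LinearMap.comp_apply, LinearMap.id_apply] at hsum
  beta_reduce
  rw [← LocalizedModule.smul'_mk, ← hsum, Finset.smul_sum, ← Finset.sum_congr rfl hterm]
  exact map_sum (LocalizedModule.mkLinearMap S X) _ _

end Order

/-! ### Infinite sums of lattices -/

universe w

/-- Every finitely generated submodule of `D` lies in a finitely generated direct summand whose
complement contains every finitely generated torsion-free module rationally: such a module `X` maps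
to the complement and back with composite a non-zero scalar. The summand is encoded as the range of
an idempotent `π`, and the complement is its kernel. -/
def HasLargeComplements (R T D : Type*) [CommRing R] [Ring T] [Algebra R T] [AddCommGroup D]
    [Module T D] :
    Prop :=
  ∀ F : Submodule T D, F.FG → ∃ π : D →ₗ[T] D, (∀ x, π (π x) = π x) ∧ F ≤ LinearMap.range π ∧
    (LinearMap.range π).FG ∧
    ∀ (X : Type w) [AddCommGroup X] [Module R X] [Module T X] [IsScalarTower R T X]
      [Module.Finite T X] [Module.IsTorsionFree R X],
      ∃ (f : X →ₗ[T] D) (g : D →ₗ[T] X) (r : R), r ≠ 0 ∧ (∀ x, g (f x) = r • x) ∧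
        (∀ x, π (f x) = 0) ∧ ∀ x, g (π x) = 0

section DirectSum

instance DirectSum.instIsTorsionFree {R ι : Type*} [Semiring R] {A : ι → Type*}
    [∀ i, AddCommMonoid (A i)] [∀ i, Module R (A i)] [∀ i, Module.IsTorsionFree R (A i)] :
    Module.IsTorsionFree R (⨁ i, A i) :=
  Function.Injective.moduleIsTorsionFree (fun x i => x i) DFunLike.coe_injective fun _ _ => rfl

variable {T : Type*} [Ring T] {A : ℕ → Type*} [∀ i, AddCommGroup (A i)] [∀ i, Module T (A i)]

/-- The projection of `⨁ i, A i` to the sum of the first `n` summands. -/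
def DirectSum.truncate (T : Type*) [Ring T] (A : ℕ → Type*) [∀ i, AddCommGroup (A i)]
    [∀ i, Module T (A i)] (n : ℕ) : (⨁ i, A i) →ₗ[T] ⨁ i, A i :=
  DirectSum.lmap fun i => if i < n then .id else 0

theorem DirectSum.truncate_apply (n : ℕ) (x : ⨁ i, A i) (i : ℕ) :
    DirectSum.truncate T A n x i = if i < n then x i else 0 := by
  rw [DirectSum.truncate, DirectSum.lmap_apply]
  split_ifs <;> rfl

theorem DirectSum.mem_range_truncate {n : ℕ} {x : ⨁ i, A i} :
    x ∈ LinearMap.range (DirectSum.truncate T A n) ↔ ∀ i, n ≤ i → x i = 0 := by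
  constructor
  · rintro ⟨y, rfl⟩ i hi
    rw [DirectSum.truncate_apply, if_neg hi.not_gt]
  · intro h
    refine ⟨x, DFinsupp.ext fun i => ?_⟩
    rw [DirectSum.truncate_apply]
    split_ifs with hi
    · rfl
    · exact (h i (not_lt.1 hi)).symm

theorem DirectSum.range_truncate_mono :
    Monotone fun n => LinearMap.range (DirectSum.truncate T A n) := fun _ _ hmn _ hx =>
  DirectSum.mem_range_truncate.2 fun i hi => DirectSum.mem_range_truncate.1 hx i (hmn.trans hi)

theorem DirectSum.exists_mem_range_truncate (x : ⨁ i, A i) :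
    ∃ n, x ∈ LinearMap.range (DirectSum.truncate T A n) := by
  obtain ⟨n, hn⟩ := (DFinsupp.finite_support x).bddAbove
  refine ⟨n + 1, DirectSum.mem_range_truncate.2 fun i hi => ?_⟩
  by_contra hne
  have := hn hne
  omega

theorem DirectSum.exists_le_range_truncate {F : Submodule T (⨁ i, A i)} (hF : F.FG) :
    ∃ n, F ≤ LinearMap.range (DirectSum.truncate T A n) := by
  obtain ⟨t, rfl⟩ := hF
  choose n hn using DirectSum.exists_mem_range_truncate (T := T) (A := A)
  exact ⟨t.sup n, Submodule.span_le.2 fun x hx =>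
    DirectSum.range_truncate_mono (Finset.le_sup (f := n) hx) (hn x)⟩

theorem DirectSum.fg_range_truncate [∀ i, Module.Finite T (A i)] (n : ℕ) :
    (LinearMap.range (DirectSum.truncate T A n)).FG := by
  have : LinearMap.range (DirectSum.truncate T A n) =
      ⨆ i ∈ Finset.range n, LinearMap.range (DirectSum.lof T ℕ A i) := by
    apply le_antisymm
    · rintro _ ⟨x, rfl⟩
      have hx : DirectSum.truncate T A n x = ∑ i ∈ Finset.range n, DirectSum.lof T ℕ A i (x i) := by
        refine DFinsupp.ext fun j => ?_
        rw [DirectSum.truncate_apply, DFinsupp.finsetSum_apply]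
        split_ifs with hj
        · rw [Finset.sum_eq_single_of_mem j (Finset.mem_range.2 hj), DirectSum.lof_apply]
          exact fun i _ hij => DirectSum.of_eq_of_ne _ _ _ hij.symm
        · refine (Finset.sum_eq_zero fun i hi => DirectSum.of_eq_of_ne _ _ _ ?_).symm
          rintro rfl
          exact hj (Finset.mem_range.1 hi)
      rw [hx]
      exact Submodule.sum_mem _ fun i hi =>
        Submodule.mem_iSup_of_mem i (Submodule.mem_iSup_of_mem hi ⟨_, rfl⟩)
    · refine iSup₂_le fun i hi => ?_
      rintro _ ⟨y, rfl⟩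
      refine DirectSum.mem_range_truncate.2 fun j hj => DirectSum.of_eq_of_ne _ _ _ ?_
      have := Finset.mem_range.1 hi
      omega
  rw [this]
  exact Submodule.fg_biSup _ _ fun i _ => Submodule.fg_range _

end DirectSum

section LargeComplements

variable {R : Type*} [CommRing R] {Λ : Type*} [Ring Λ] [Algebra R Λ]

theorem HasLargeComplements.directSum [IsDomain R] [Module.Finite R Λ]
    (Q : Type*) [Field Q] [Algebra R Q] [IsFractionRing R Q] (hsimple : IsSimpleRing (Λ ⊗[R] Q))
    (hartinian : IsArtinianRing (Λ ⊗[R] Q)) (A : ℕ → Type*) [∀ i, AddCommGroup (A i)]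
    [∀ i, Module R (A i)] [∀ i, Module Λᵐᵒᵖ (A i)] [∀ i, IsScalarTower R Λᵐᵒᵖ (A i)]
    [∀ i, Nontrivial (A i)] [∀ i, Module.Finite Λᵐᵒᵖ (A i)] [∀ i, Module.IsTorsionFree R (A i)] :
    HasLargeComplements.{w} R Λᵐᵒᵖ (⨁ i, A i) := by
  intro F hF
  obtain ⟨n, hn⟩ := DirectSum.exists_le_range_truncate hF
  refine ⟨DirectSum.truncate Λᵐᵒᵖ A n, fun x => DFinsupp.ext fun i => ?_, hn,
    DirectSum.fg_range_truncate n, ?_⟩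
  · rw [DirectSum.truncate_apply, DirectSum.truncate_apply]; split_ifs <;> rfl
  intro X _ _ _ _ _ _
  obtain ⟨l, f, g, r, hr, h⟩ := exists_sum_comp_eq_smul Q hsimple hartinian X fun j => A (n + j)
  refine ⟨∑ j ∈ Finset.range l, DirectSum.lof Λᵐᵒᵖ ℕ A (n + j) ∘ₗ f j,
    ∑ j ∈ Finset.range l, g j ∘ₗ DirectSum.component Λᵐᵒᵖ ℕ A (n + j), r, hr, ?_, ?_, ?_⟩
  · intro x
    rw [← h x]
    simp only [LinearMap.sum_apply, LinearMap.comp_apply]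
    refine Finset.sum_congr rfl fun j hj => congrArg (g j) ?_
    rw [map_sum, Finset.sum_eq_single_of_mem j hj, DirectSum.component.lof_self]
    exact fun k _ hkj => DirectSum.of_eq_of_ne _ _ _ (by omega)
  · intro x
    simp only [LinearMap.sum_apply, LinearMap.comp_apply, map_sum]
    refine Finset.sum_eq_zero fun j _ => DFinsupp.ext fun i => ?_
    rw [DirectSum.truncate_apply]
    split_ifs with hi
    · exact DirectSum.of_eq_of_ne _ _ _ (by omega)
    · rfl
  · intro x
    simp only [LinearMap.sum_apply, LinearMap.comp_apply]
    refine Finset.sum_eq_zero fun j _ => ?_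
    rw [← DirectSum.apply_eq_component, DirectSum.truncate_apply, if_neg (by omega), map_zero]

/-- Large complements persist when a finitely generated direct summand is removed. -/
theorem HasLargeComplements.of_isCompl {T M : Type*} [Ring T] [Algebra R T] [AddCommGroup M]
    [Module T M] (hM : HasLargeComplements.{w} R T M) {P D : Submodule T M} (h : IsCompl P D)
    (hP : P.FG) : HasLargeComplements.{w} R T D := by
  intro F hF
  obtain ⟨π, hπ, hle, hfg, hX⟩ := hM (P ⊔ F.map D.subtype) (hP.sup (hF.map _))
  let q : M →ₗ[T] D := D.projectionOnto P h.symm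
  have hqD : ∀ x : D, q x = x := fun x => Submodule.projectionOnto_apply_left h.symm x
  have hqP : ∀ x, x - q x ∈ P := fun x => by
    rw [← Submodule.projectionOnto_apply_eq_zero_iff h.symm]
    change q (x - q x) = 0
    rw [map_sub, hqD, sub_self]
  have hqP0 : ∀ x ∈ P, q x = 0 := fun x hx =>
    (Submodule.projectionOnto_apply_eq_zero_iff h.symm).2 hx
  have hπfix : ∀ x ∈ LinearMap.range π, π x = x := by
    rintro _ ⟨x, rfl⟩; exact hπ x
  have hπP : ∀ x ∈ P, π x = x := fun x hx => hπfix x (hle (Submodule.mem_sup_left hx))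
  have hπq : ∀ x, π (q x) = π x - (x - q x) := fun x => by
    rw [← hπP _ (hqP x), map_sub]; abel
  have hqπq : ∀ x, q (π (q x)) = q (π x) := fun x => by
    rw [hπq, map_sub, hqP0 _ (hqP x), sub_zero]
  refine ⟨q ∘ₗ π ∘ₗ D.subtype, fun x => ?_, fun x hx => ⟨x, ?_⟩, ?_, ?_⟩
  · simp only [LinearMap.comp_apply, Submodule.subtype_apply, hqπq, hπ]
  · have : (x : M) ∈ LinearMap.range π :=
      hle (Submodule.mem_sup_right (Submodule.mem_map_of_mem hx))
    simp only [LinearMap.comp_apply, Submodule.subtype_apply, hπfix _ this, hqD]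
  · have : LinearMap.range (q ∘ₗ π ∘ₗ D.subtype) = (LinearMap.range π).map q := by
      apply le_antisymm
      · rintro _ ⟨x, rfl⟩
        exact ⟨_, ⟨x, rfl⟩, rfl⟩
      · rintro _ ⟨_, ⟨x, rfl⟩, rfl⟩
        exact ⟨q x, hqπq x⟩
    rw [this]
    exact hfg.map _
  · intro X _ _ _ _ _ _
    obtain ⟨f, g, r, hr, hgf, hπf, hgπ⟩ := hX X
    have hgq : ∀ x, g (q x) = g x := fun x => by
      have : g (x - q x) = 0 := by rw [← hπP _ (hqP x), hgπ]
      rw [map_sub, sub_eq_zero] at this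
      exact this.symm
    refine ⟨q ∘ₗ f, g ∘ₗ D.subtype, r, hr, fun x => ?_, fun x => ?_, fun x => ?_⟩
    · simp only [LinearMap.comp_apply, Submodule.subtype_apply, hgq, hgf]
    · simp only [LinearMap.comp_apply, Submodule.subtype_apply, hqπq, hπf, map_zero]
    · simp only [LinearMap.comp_apply, Submodule.subtype_apply, hgq, hgπ]

end LargeComplements

/-! ### Transferring direct summands within a genus -/

section Transfer

variable {R : Type*} [CommRing R] [IsDomain R] {Λ : Type*} [Ring Λ] [Algebra R Λ]
  {D : Type*} [AddCommGroup D] [Module R D] [Module Λᵐᵒᵖ D] [IsScalarTower R Λᵐᵒᵖ D]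
  {D' : Type*} [AddCommGroup D'] [Module R D'] [Module Λᵐᵒᵖ D'] [IsScalarTower R Λᵐᵒᵖ D']
  [Module.IsTorsionFree R D']
  {X : Type w} [AddCommGroup X] [Module R X] [Module Λᵐᵒᵖ X] [IsScalarTower R Λᵐᵒᵖ X]
  [Module.Finite Λᵐᵒᵖ X] [Module.IsTorsionFree R X]

/-- The local form of `HasLargeComplements.exists_comp_eq_id`: the isomorphism of localizations
gives maps whose composite is a unit locally at `m`. -/
theorem HasLargeComplements.exists_comp_eq_smul_of_notMem
    (hD' : HasLargeComplements.{w} R Λᵐᵒᵖ D') (hgenus : InSameGenus R Λ D D')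
    {i : X →ₗ[Λᵐᵒᵖ] D} {p : D →ₗ[Λᵐᵒᵖ] X} (hp : ∀ x, p (i x) = x) (m : MaximalSpectrum R) :
    ∃ (f : X →ₗ[Λᵐᵒᵖ] D') (g : D' →ₗ[Λᵐᵒᵖ] X), ∃ s ∉ m.asIdeal, ∀ x, g (f x) = s • x := by
  have := m.isMaximal.isPrime
  obtain ⟨φ⟩ := hgenus m
  have hS : m.asIdeal.primeCompl ≤ nonZeroDivisors R := m.asIdeal.primeCompl_le_nonZeroDivisors
  obtain ⟨s, f, hf⟩ := LocalizedModule.exists_rightMap_eq_smul m.asIdeal.primeCompl hS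
    (φ.toLinearMap ∘ₗ LocalizedModule.rightMap _ i)
  -- The inverse isomorphism can only be lifted on a finitely generated summand containing the
  -- image of `f`.
  obtain ⟨π, hπ, hle, hfg, -⟩ := hD' (LinearMap.range f) (Submodule.fg_range f)
  have : Module.Finite Λᵐᵒᵖ (LinearMap.range π) := .of_fg hfg
  obtain ⟨t, g, hg⟩ := LocalizedModule.exists_rightMap_eq_smul m.asIdeal.primeCompl hS
    (LocalizedModule.rightMap _ p ∘ₗ φ.symm.toLinearMap ∘ₗ
      LocalizedModule.rightMap _ (LinearMap.range π).subtype)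
  refine ⟨f, g ∘ₗ π.rangeRestrict, t * s, ?_, fun x => ?_⟩
  · exact (t * s).2
  have hfx : ((π.rangeRestrict (f x) : LinearMap.range π) : D') = f x := by
    obtain ⟨y, hy⟩ := hle ⟨x, rfl⟩
    change π (f x) = f x
    rw [← hy, hπ]
  apply LocalizedModule.mk_one_injective m.asIdeal.primeCompl hS
  beta_reduce
  rw [LinearMap.comp_apply, ← LocalizedModule.rightMap_mk, hg]
  simp only [LinearMap.comp_apply, LocalizedModule.rightMap_mk, Submodule.subtype_apply, hfx]
  have hφ : ∀ (r : R) z, φ.symm (r • z) = r • φ.symm z := fun r z =>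
    φ.symm.toLinearMap.map_smul_of_tower r z
  rw [← LocalizedModule.rightMap_mk, hf, LinearEquiv.coe_coe, hφ]
  simp only [LinearMap.comp_apply, LocalizedModule.rightMap_mk, LinearEquiv.coe_coe,
    LinearEquiv.symm_apply_apply]
  rw [LinearMap.map_smul_of_tower, LocalizedModule.rightMap_mk, hp, smul_smul,
    LocalizedModule.smul'_mk]

/-- A finitely generated direct summand `X` of `D` is a direct summand of every module `D'` in the
genus of `D`, as soon as `D'` has large complements. -/
theorem HasLargeComplements.exists_comp_eq_id [Module.Finite R Λ] (hR : HasFiniteCharacter R)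
    (hD' : HasLargeComplements.{w} R Λᵐᵒᵖ D') (hgenus : InSameGenus R Λ D D')
    {i : X →ₗ[Λᵐᵒᵖ] D} {p : D →ₗ[Λᵐᵒᵖ] X} (hp : p ∘ₗ i = .id) :
    ∃ (f : X →ₗ[Λᵐᵒᵖ] D') (g : D' →ₗ[Λᵐᵒᵖ] X), g ∘ₗ f = .id := by
  have : Module.Finite R X := .of_mulOpposite Λ X
  obtain ⟨_, _, _, _, h⟩ := hD' ⊥ Submodule.fg_bot
  obtain ⟨f₁, g₁, r₁, hr₁, h₁, -⟩ := h X
  -- Two pairs `f₁, g₁` and `f', g'`, one of which splits at any given maximal ideal.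
  obtain ⟨f', g', s', hs', h'⟩ := LinearMap.exists_comp_eq_smul_of_finset (hR r₁ hr₁).toFinset
    fun m _ => hD'.exists_comp_eq_smul_of_notMem hgenus (LinearMap.congr_fun hp) m
  obtain ⟨π, hπ, hle, -, h⟩ := hD' (LinearMap.range f₁ ⊔ LinearMap.range f')
    ((Submodule.fg_range f₁).sup (Submodule.fg_range f'))
  obtain ⟨f₂, g₂, r₂, hr₂, h₂, hπf₂, hg₂π⟩ := h X
  have hπfix : ∀ x ∈ LinearMap.range π, π x = x := by
    rintro _ ⟨x, rfl⟩; exact hπ x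
  -- At the maximal ideals containing `r₂`, these pairs combine to one through the range of `π`.
  obtain ⟨f, g, s, hs, h⟩ := LinearMap.exists_comp_eq_smul_of_finset (T := Λᵐᵒᵖ) (X := X)
    (Y := LinearMap.range π) (hR r₂ hr₂).toFinset fun m _ => by
      by_cases hm : r₁ ∈ m.asIdeal
      · exact ⟨f'.codRestrict _ fun x => hle (Submodule.mem_sup_right ⟨x, rfl⟩),
          g' ∘ₗ (LinearMap.range π).subtype, s', hs' m (by simpa using hm), h'⟩
      · exact ⟨f₁.codRestrict _ fun x => hle (Submodule.mem_sup_left ⟨x, rfl⟩),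
          g₁ ∘ₗ (LinearMap.range π).subtype, r₁, hm, h₁⟩
  have hcop : IsCoprime s r₂ := by
    rw [← Ideal.isCoprime_span_singleton_iff, Ideal.isCoprime_iff_sup_eq]
    by_contra hne
    obtain ⟨m, hm, hle⟩ := Ideal.exists_le_maximal _ hne
    rw [sup_le_iff, Ideal.span_singleton_le_iff_mem, Ideal.span_singleton_le_iff_mem] at hle
    exact hs ⟨m, hm⟩ (by simpa using hle.2) hle.1
  obtain ⟨a, b, hab⟩ := hcop
  refine ⟨(LinearMap.range π).subtype ∘ₗ f + f₂, a • (g ∘ₗ π.rangeRestrict) + b • g₂, ?_⟩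
  ext x
  have e₁ : π.rangeRestrict (f x : D') = f x := Subtype.ext (hπfix _ (f x).2)
  have e₂ : π.rangeRestrict (f₂ x) = 0 := Subtype.ext (hπf₂ x)
  have e₃ : g₂ (f x) = 0 := by rw [← hπfix _ (f x).2, hg₂π]
  simp only [LinearMap.comp_apply, LinearMap.add_apply, LinearMap.smul_apply, map_add,
    Submodule.subtype_apply, e₁, e₂, e₃, map_zero, smul_zero, add_zero, zero_add, h, h₂, smul_smul,
    LinearMap.id_apply]
  rw [← add_smul, hab, one_smul]

end Transfer

/-! ### The back-and-forth construction -/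

universe u v

/-- Successively splitting off direct complements exhausts a module by an internal direct sum. -/
theorem DirectSum.isInternal_of_isCompl_chain {T M : Type*} [Ring T] [AddCommGroup M] [Module T M]
    {P U : ℕ → Submodule T M} (h0 : P 0 = ⊥) (hsucc : ∀ n, P (n + 1) = P n ⊔ U n)
    (hdisj : ∀ n, Disjoint (P n) (U n)) (htop : ⨆ n, P n = ⊤) : DirectSum.IsInternal U := by
  have hP : ∀ n, P n = (Finset.range n).sup U := fun n => by
    induction n with
    | zero => simpa using h0
    | succ n ih => rw [hsucc, ih, Finset.range_add_one, Finset.sup_insert, sup_comm]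
  have hind : ∀ n, (Finset.range n).SupIndep U := fun n => by
    induction n with
    | zero => simp
    | succ n ih =>
      rw [Finset.range_add_one]
      exact ih.insert (by rw [← hP]; exact (hdisj n).symm)
  refine DirectSum.isInternal_submodule_of_iSupIndep_of_iSup_eq_top
    (iSupIndep_iff_supIndep.2 fun s => ?_) (top_le_iff.1 (htop ▸ iSup_le fun n => ?_))
  · obtain ⟨n, hn⟩ := s.exists_nat_subset_range
    exact (hind n).subset hn
  · rw [hP]
    exact Finset.sup_le fun i _ => le_iSup U i

section Split

variable {T M X : Type*} [Ring T] [AddCommGroup M] [Module T M] [AddCommGroup X] [Module T X]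

/-- If `X` is split off from a complement `D` of `P`, what remains of `D` is a complement of
`P ⊕ X`. -/
theorem Submodule.isCompl_sup_map_range {P D : Submodule T M} (h : IsCompl P D) {f : X →ₗ[T] D}
    {g : D →ₗ[T] X} (hgf : g ∘ₗ f = .id) :
    IsCompl (P ⊔ (LinearMap.range f).map D.subtype) ((LinearMap.ker g).map D.subtype) := by
  have hgf' : ∀ x, g (f x) = x := LinearMap.congr_fun hgf
  have hdisj : Disjoint ((LinearMap.range f).map D.subtype) ((LinearMap.ker g).map D.subtype) := by
    rw [Submodule.disjoint_def]
    rintro _ ⟨_, ⟨x, rfl⟩, rfl⟩ ⟨y, hy, hxy⟩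
    rw [Subtype.ext hxy] at hy
    rw [show x = 0 by simpa [hgf'] using hy, map_zero, map_zero]
  have hsup : (LinearMap.range f).map D.subtype ⊔ (LinearMap.ker g).map D.subtype = D := by
    apply le_antisymm (sup_le (Submodule.map_subtype_le _ _) (Submodule.map_subtype_le _ _))
    intro x hx
    have : (x : M) = f (g ⟨x, hx⟩) + (⟨x, hx⟩ - f (g ⟨x, hx⟩) : D) := by simp
    rw [this]
    exact Submodule.add_mem_sup ⟨_, ⟨_, rfl⟩, rfl⟩
      ⟨⟨x, hx⟩ - f (g ⟨x, hx⟩), by simp [hgf'], rfl⟩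
  exact hdisj.isCompl_sup_left_of_isCompl_sup_right (hsup.symm ▸ h)

end Split

section BackAndForth

variable {R : Type*} [CommRing R] {Λ : Type*} [Ring Λ] [Algebra R Λ]
  {M : Type u} [AddCommGroup M] [Module R M] [Module Λᵐᵒᵖ M] [IsScalarTower R Λᵐᵒᵖ M]
  {N : Type v} [AddCommGroup N] [Module R N] [Module Λᵐᵒᵖ N] [IsScalarTower R Λᵐᵒᵖ N]

variable (R Λ M N) in
/-- Decompositions `M = left ⊕ leftCompl` and `N = right ⊕ rightCompl` with finitely generated first
summands and second summands in the same genus. -/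
structure GenusSplitting where
  left : Submodule Λᵐᵒᵖ M
  leftCompl : Submodule Λᵐᵒᵖ M
  right : Submodule Λᵐᵒᵖ N
  rightCompl : Submodule Λᵐᵒᵖ N
  isCompl_left : IsCompl left leftCompl
  isCompl_right : IsCompl right rightCompl
  left_fg : left.FG
  right_fg : right.FG
  inSameGenus : InSameGenus R Λ leftCompl rightCompl

namespace GenusSplitting

/-- Interchange of the two modules. -/
def swap (σ : GenusSplitting R Λ M N) : GenusSplitting R Λ N M :=
  ⟨σ.right, σ.rightCompl, σ.left, σ.leftCompl, σ.isCompl_right, σ.isCompl_left, σ.right_fg,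
    σ.left_fg, σ.inSameGenus.symm⟩

/-- The splitting `τ` arises from `σ` by adding `U` to `σ.left` and `V` to `σ.right`, where
`U ≅ V` are finitely generated. -/
structure Extends (σ τ : GenusSplitting R Λ M N) (U : Submodule Λᵐᵒᵖ M) (V : Submodule Λᵐᵒᵖ N) :
    Prop where
  left_eq : τ.left = σ.left ⊔ U
  right_eq : τ.right = σ.right ⊔ V
  disjoint_left : Disjoint σ.left U
  disjoint_right : Disjoint σ.right V
  left_fg : U.FG
  right_fg : V.FG
  nonempty_equiv : Nonempty (U ≃ₗ[Λᵐᵒᵖ] V)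

/-- Any finitely generated submodule of `M` can be absorbed into the first summand. -/
theorem exists_extends_le [IsDomain R] [Module.Finite R Λ] (hR : HasFiniteCharacter R)
    [Module.IsTorsionFree R M] [Module.IsTorsionFree R N]
    (hM : HasLargeComplements.{v} R Λᵐᵒᵖ M) (hN : HasLargeComplements.{u} R Λᵐᵒᵖ N)
    (σ : GenusSplitting R Λ M N) {F : Submodule Λᵐᵒᵖ M} (hF : F.FG) :
    ∃ τ U V, σ.Extends τ U V ∧ F ≤ τ.left := by
  let q : M →ₗ[Λᵐᵒᵖ] σ.leftCompl := σ.leftCompl.projectionOnto σ.left σ.isCompl_left.symm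
  obtain ⟨π, hπ, hle, hfg, -⟩ := hM.of_isCompl σ.isCompl_left σ.left_fg (F.map q) (hF.map q)
  have hN' := hN.of_isCompl σ.isCompl_right σ.right_fg
  have : Module.Finite Λᵐᵒᵖ (LinearMap.range π) := .of_fg hfg
  have hπ' : π.rangeRestrict ∘ₗ (LinearMap.range π).subtype = .id := by
    ext ⟨_, x, rfl⟩
    exact congrArg Subtype.val (hπ x)
  obtain ⟨f, g, hgf⟩ := hN'.exists_comp_eq_id (X := LinearMap.range π) hR σ.inSameGenus hπ'
  have hfinj : Function.Injective f :=
    Function.LeftInverse.injective (g := g) (LinearMap.congr_fun hgf)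
  let K := (LinearMap.ker π.rangeRestrict).map σ.leftCompl.subtype
  let L := (LinearMap.ker g).map σ.rightCompl.subtype
  let U := (LinearMap.range (LinearMap.range π).subtype).map σ.leftCompl.subtype
  let V := (LinearMap.range f).map σ.rightCompl.subtype
  have hU : U.FG := (Submodule.fg_range _).map _
  have hV : V.FG := (Submodule.fg_range _).map _
  have eK := Submodule.equivMapOfInjective σ.leftCompl.subtype
    σ.leftCompl.subtype_injective (LinearMap.ker π.rangeRestrict)
  have eL := Submodule.equivMapOfInjective σ.rightCompl.subtype
    σ.rightCompl.subtype_injective (LinearMap.ker g)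
  have eU := (LinearEquiv.ofInjective _ (LinearMap.range π).subtype_injective).trans
    (Submodule.equivMapOfInjective σ.leftCompl.subtype σ.leftCompl.subtype_injective _)
  have eV := (LinearEquiv.ofInjective f hfinj).trans
    (Submodule.equivMapOfInjective σ.rightCompl.subtype σ.rightCompl.subtype_injective _)
  have hK : InSameGenus R Λ K L := (InSameGenus.of_linearEquiv eK.symm).trans
    ((σ.inSameGenus.ker hπ' hgf).trans (.of_linearEquiv eL))
  have hUK : IsCompl (σ.left ⊔ U) K :=
    Submodule.isCompl_sup_map_range (X := LinearMap.range π) σ.isCompl_left hπ'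
  have hVL : IsCompl (σ.right ⊔ V) L :=
    Submodule.isCompl_sup_map_range (X := LinearMap.range π) σ.isCompl_right hgf
  have hdU : Disjoint σ.left U :=
    σ.isCompl_left.disjoint.mono_right (Submodule.map_subtype_le _ _)
  have hdV : Disjoint σ.right V :=
    σ.isCompl_right.disjoint.mono_right (Submodule.map_subtype_le _ _)
  have eUV : Nonempty (U ≃ₗ[Λᵐᵒᵖ] V) := ⟨eU.symm.trans eV⟩
  have hFU : F ≤ σ.left ⊔ U := fun x hx => by
    have hxq : x - q x ∈ σ.left := by
      rw [← Submodule.projectionOnto_apply_eq_zero_iff σ.isCompl_left.symm]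
      change q (x - q x) = 0
      rw [map_sub, Submodule.projectionOnto_apply_left, sub_self]
    rw [← sub_add_cancel x (q x)]
    refine Submodule.add_mem_sup hxq ⟨q x, ?_, rfl⟩
    rw [SetLike.mem_coe, Submodule.range_subtype]
    exact hle ⟨x, hx, rfl⟩
  clear_value U V K L
  exact ⟨⟨σ.left ⊔ U, K, σ.right ⊔ V, L, hUK, hVL, σ.left_fg.sup hU, σ.right_fg.sup hV, hK⟩,
    U, V, ⟨rfl, rfl, hdU, hdV, hU, hV, eUV⟩, hFU⟩

/-- The limit of the back-and-forth construction, which starts from `M = 0 ⊕ M` and `N = 0 ⊕ N`. -/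
theorem exists_isInternal [IsDomain R] [Module.Finite R Λ] (hR : HasFiniteCharacter R)
    [Module.IsTorsionFree R M] [Module.IsTorsionFree R N]
    (hM : HasLargeComplements.{v} R Λᵐᵒᵖ M) (hN : HasLargeComplements.{u} R Λᵐᵒᵖ N)
    (hgenus : InSameGenus R Λ M N) {F : ℕ → Submodule Λᵐᵒᵖ M} (hF : ∀ n, (F n).FG)
    (hFtop : ⨆ n, F n = ⊤) {G : ℕ → Submodule Λᵐᵒᵖ N} (hG : ∀ n, (G n).FG) (hGtop : ⨆ n, G n = ⊤) :
    ∃ (U : ℕ → Submodule Λᵐᵒᵖ M) (V : ℕ → Submodule Λᵐᵒᵖ N), DirectSum.IsInternal U ∧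
      DirectSum.IsInternal V ∧ ∀ i, (U i).FG ∧ (V i).FG ∧ Nonempty (U i ≃ₗ[Λᵐᵒᵖ] V i) := by
  -- Odd steps absorb a generating submodule of `M`, even steps one of `N`.
  have hstep : ∀ (n : ℕ) (σ : GenusSplitting R Λ M N), ∃ τ U V, σ.Extends τ U V ∧
      (n % 2 = 1 → F (n / 2) ≤ τ.left) ∧ (n % 2 = 0 → G (n / 2) ≤ τ.right) := by
    intro n σ
    rcases Nat.mod_two_eq_zero_or_one n with hn | hn
    · obtain ⟨τ, V, U, h, hle⟩ := exists_extends_le hR hN hM σ.swap (hG (n / 2))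
      exact ⟨τ.swap, U, V, ⟨h.right_eq, h.left_eq, h.disjoint_right, h.disjoint_left, h.right_fg,
        h.left_fg, h.nonempty_equiv.map LinearEquiv.symm⟩, by omega, fun _ => hle⟩
    · obtain ⟨τ, U, V, h, hle⟩ := exists_extends_le hR hM hN σ (hF (n / 2))
      exact ⟨τ, U, V, h, fun _ => hle, by omega⟩
  choose τ U V hext hFle hGle using hstep
  let σ₀ : GenusSplitting R Λ M N := ⟨⊥, ⊤, ⊥, ⊤, isCompl_bot_top, isCompl_bot_top,
    Submodule.fg_bot, Submodule.fg_bot, (InSameGenus.of_linearEquiv Submodule.topEquiv).trans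
      (hgenus.trans (.of_linearEquiv Submodule.topEquiv.symm))⟩
  let σ : ℕ → GenusSplitting R Λ M N := fun n => Nat.rec σ₀ τ n
  have hσ : ∀ n, (σ n).Extends (σ (n + 1)) (U n (σ n)) (V n (σ n)) := fun n => hext n (σ n)
  refine ⟨fun n => U n (σ n), fun n => V n (σ n),
    DirectSum.isInternal_of_isCompl_chain (P := fun n => (σ n).left) rfl (fun n => (hσ n).left_eq)
      (fun n => (hσ n).disjoint_left) ?_,
    DirectSum.isInternal_of_isCompl_chain (P := fun n => (σ n).right) rfl
      (fun n => (hσ n).right_eq) (fun n => (hσ n).disjoint_right) ?_,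
    fun n => ⟨(hσ n).left_fg, (hσ n).right_fg, (hσ n).nonempty_equiv⟩⟩
  · refine top_le_iff.1 (hFtop ▸ iSup_le fun n => ?_)
    have := hFle (2 * n + 1) (σ (2 * n + 1)) (by omega)
    rw [show (2 * n + 1) / 2 = n by omega] at this
    exact this.trans (le_iSup (fun n => (σ n).left) (2 * n + 1 + 1))
  · refine top_le_iff.1 (hGtop ▸ iSup_le fun n => ?_)
    have := hGle (2 * n) (σ (2 * n)) (by omega)
    rw [show (2 * n) / 2 = n by omega] at this
    exact this.trans (le_iSup (fun n => (σ n).right) (2 * n + 1))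

end GenusSplitting

end BackAndForth

theorem mainTheorem5
    {R : Type*} [CommRing R] [IsDomain R] (hR : HasFiniteCharacter R)
    (Q : Type*) [Field Q] [Algebra R Q] [IsFractionRing R Q]
    {Λ : Type*} [Ring Λ] [Algebra R Λ] [Module.Finite R Λ]
    (hsimple : IsSimpleRing (Λ ⊗[R] Q)) (hartinian : IsArtinianRing (Λ ⊗[R] Q))
    (A : ℕ → Type*) [∀ i, AddCommGroup (A i)] [∀ i, Module R (A i)] [∀ i, Module Λᵐᵒᵖ (A i)]
    [∀ i, IsScalarTower R Λᵐᵒᵖ (A i)]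
    (B : ℕ → Type*) [∀ i, AddCommGroup (B i)] [∀ i, Module R (B i)] [∀ i, Module Λᵐᵒᵖ (B i)]
    [∀ i, IsScalarTower R Λᵐᵒᵖ (B i)]
    (hA_ne : ∀ i, Nontrivial (A i)) (hA_fg : ∀ i, Module.Finite Λᵐᵒᵖ (A i))
    (hA_tf : ∀ i, Module.IsTorsionFree R (A i))
    (hB_ne : ∀ i, Nontrivial (B i)) (hB_fg : ∀ i, Module.Finite Λᵐᵒᵖ (B i))
    (hB_tf : ∀ i, Module.IsTorsionFree R (B i))
    (hgenus : InSameGenus R Λ (⨁ i, A i) (⨁ i, B i)) :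
    (∃ (M : ℕ → Submodule Λᵐᵒᵖ (⨁ i, A i)) (N : ℕ → Submodule Λᵐᵒᵖ (⨁ i, B i)),
      DirectSum.IsInternal M ∧ DirectSum.IsInternal N ∧
      ∀ i, (M i).FG ∧ (N i).FG ∧ Nonempty (M i ≃ₗ[Λᵐᵒᵖ] N i)) ∧
    Nonempty ((⨁ i, A i) ≃ₗ[Λᵐᵒᵖ] (⨁ i, B i)) := by
  have hM := fun n => DirectSum.fg_range_truncate (T := Λᵐᵒᵖ) (A := A) n
  have hN := fun n => DirectSum.fg_range_truncate (T := Λᵐᵒᵖ) (A := B) n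
  obtain ⟨U, V, hU, hV, h⟩ := GenusSplitting.exists_isInternal hR
    (.directSum Q hsimple hartinian A) (.directSum Q hsimple hartinian B) hgenus hM
    (Submodule.eq_top_iff'.2 fun x =>
      have ⟨n, hn⟩ := DirectSum.exists_mem_range_truncate x
      Submodule.mem_iSup_of_mem n hn) hN
    (Submodule.eq_top_iff'.2 fun x =>
      have ⟨n, hn⟩ := DirectSum.exists_mem_range_truncate x
      Submodule.mem_iSup_of_mem n hn)
  refine ⟨⟨U, V, hU, hV, h⟩, ⟨?_⟩⟩
  exact (LinearEquiv.ofBijective (DirectSum.coeLinearMap U) hU).symm.trans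
    ((DFinsupp.mapRange.linearEquiv fun i => (h i).2.2.some).trans
      (LinearEquiv.ofBijective (DirectSum.coeLinearMap V) hV))
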